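/- **Setting.** Let $\nu\in\mathbb S^2$, $\mathcal L_\nu=\{t\nu:t\in\mathbb R\}\subset\mathbb R^3$, and let $\theta,\omega:\mathbb R^3\setminus\mathcal L_\nu\to\mathbb S^2$ be smooth with $\theta(p)\cdot p=\omega(p)\cdot p=\theta(p)\cdot\omega(p)=0$ and $\omega(p)=p\times\theta(p)/|p|$. Let $\lambda_0:\mathbb R^3\setminus\mathcal L_\nu\to\{\lambda\in\mathbb C:|\lambda|=1\}$ be (Lebesgue) measurable, for example piecewise continuous. For $\lambda\in\mathbb C\setminus0$, $p\in\mathbb R^3\setminus\mathcal L_\nu$ and $\varphi\in[-\pi,\pi]$ put $$k(\lambda,p)=\tfrac{i|p|}{4}\bigl(\lambda+\tfrac1\lambda\bigr)\theta(p)+\tfrac{|p|}{4}\bigl(\lambda-\tfrac1\lambda\bigr)\omega(p)+\tfrac p2\in\mathbb C^3,$$ $$\xi(\lambda,p,\varphi)=\mathrm{Re}\,k\,(\cos\varphi-1)+\frac{\mathrm{Im}\,k\times\mathrm{Re}\,k}{|\mathrm{Im}\,k|}\sin\varphi,\qquad k=k(\lambda,p),$$ and, for $k\in\mathbb C^3$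 and $p\in\mathbb R^3\setminus\mathcal L_\nu$ with $k\cdot k=0$, $p\cdot p=2k\cdot p$ (bilinear products), $\lambda(k,p)=\dfrac{2k\cdot(\theta(p)+i\omega(p))}{i|p|}$. For functions $U,U_1,U_2$ on $(\mathbb C\setminus0)\times(\mathbb R^3\setminus\mathcal L_\nu)$ put $U_j'(k,p)=U_j(\lambda(k,p),p)$ and $$(U_1,U_2)(\lambda,p)=-\frac\pi4\int_{-\pi}^{\pi}\Bigl(\frac{|p|}2\,\frac{|\lambda|^2-1}{\bar\lambda|\lambda|}(\cos\varphi-1)-\frac{|p|}{\bar\lambda}\sin\varphi\Bigr)U_1'(k,-\xi)\,U_2'(k+\xi,p+\xi)\,d\varphi,$$ with $k=k(\lambda,p)$, $\xi=\xi(\lambda,p,\varphi)$. Further, let $$I(U_1,U_2)(\lambda,p)=-\frac1\pi\int_{\mathbb C}(U_1,U_2)(\zeta,p)\frac{d\,\mathrm{Re}\,\zeta\,d\,\mathrm{Im}\,\zeta}{\zeta-\lambda},\qquad N(U)=I(U,U),$$ $$M(U)(\lambda,p)=-\frac1\pi\int_{\mathbb C}(U,U)(\zeta,p)\Bigl(\frac1{\zeta-\lambda}-\frac1{\zeta-\lambda_0(p)}\Bigr)d\,\mathrm{Re}\,\zeta\,d\,\mathrm{Im}\,\zeta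 .$$ Let $L^\infty_\mu=L^\infty_\mu((\mathbb C\setminus0)\times(\mathbb R^3\setminus\mathcal L_\nu))$ be the space of $U\in L^\infty$ with $|||U|||_\mu=\operatorname{ess\,sup}_{\lambda,p}(1+|p|)^\mu|U(\lambda,p)|<\infty$. **Lemma 6.1.** For every real $\mu\ge2$ there is a constant $c_6=c_6(\mu)>0$, depending only on $\mu$, such that for all $\nu,\theta,\omega,\lambda_0$ as above and all $U,U_1,U_2\in L^\infty_\mu$ the following holds. 1. The integral defining $(U_1,U_2)(\lambda,p)$ converges absolutely for almost every $(\lambda,p)$. For almost every $p$ and every $\lambda\in\mathbb C\setminus0$, the integral defining $I(U_1,U_2)(\lambda,p)$ converges absolutely. The operator $I$ is bilinear and does not depend on the choice of representatives of $U_1,U_2$, and $M(U)(\lambda,p)=N(U)(\lambda,p)-N(U)(\lambda_0(p),p)$; these identities hold for almost every $p$ and every $\lambda\in\mathbb C\setminus0$. 2. $I(U_1,U_2),N(U),M(U)\in L^\infty_\mu$, and for almost every $p$ the functions $I(U_1,U_2)(\cdot,p)$, $N(U)(\cdot,p)$, $M(U)(\cdot,p)$ belong to $C(\mathbb C\setminus0)\cap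 L^\infty(\mathbb C\setminus0)$. 3. $|||I(U_1,U_2)|||_\mu\le c_6|||U_1|||_\mu|||U_2|||_\mu$, $\ |||N(U)|||_\mu\le c_6|||U|||_\mu^2$, $\ |||M(U)|||_\mu\le2c_6|||U|||_\mu^2$. 4. $|||N(U_1)-N(U_2)|||_\mu\le c_6(|||U_1|||_\mu+|||U_2|||_\mu)\,|||U_1-U_2|||_\mu$ and $|||M(U_1)-M(U_2)|||_\mu\le2c_6(|||U_1|||_\mu+|||U_2|||_\mu)\,|||U_1-U_2|||_\mu$. 5. (Solvability and stability for small data.) Let $0<r<1/(4c_6)$, $U_0\in L^\infty_\mu$ and $|||U_0|||_\mu\le r/2$. Then the equation $U=U_0+M(U)$ has a unique solution $U\in L^\infty_\mu$ with $|||U|||_\mu\le r$, and the iterates $(M_{U_0})^n(0)$ of the map $M_{U_0}:V\mapsto U_0+M(V)$ lie in $L^\infty_\mu$ and satisfy $$|||U-(M_{U_0})^n(0)|||_\mu\le\frac{r(4c_6r)^n}{2(1-4c_6r)},\qquad n=0,1,2,\dots$$ If also $\tilde U_0\in L^\infty_\mu$, $|||\tilde U_0|||_\mu\le r/2$, and $\tilde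 U$ is the solution of $\tilde U=\tilde U_0+M(\tilde U)$ with $|||\tilde U|||_\mu\le r$, then $|||U-\tilde U|||_\mu\le|||U_0-\tilde U_0|||_\mu/(1-4c_6r)$. -/

import Mathlib

open MeasureTheory Filter Topology

noncomputable section

namespace FaddeevInverse

/-- Euclidean three-space. -/
abbrev E3 : Type := EuclideanSpace ℝ (Fin 3)

/-- The vector product in `ℝ³`. -/
def cross (a b : E3) : E3 := WithLp.toLp 2 (crossProduct a.ofLp b.ofLp)

/-- The line `{t ν : t ∈ ℝ}`. -/
def axis (ν : E3) : Set E3 := {p | ∃ t : ℝ, p = t • ν}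

/-- The set `(ℂ \ 0) × (ℝ³ \ axis ν)`. -/
def dom (ν : E3) : Set (ℂ × E3) := {0}ᶜ ×ˢ (axis ν)ᶜ

/-- `θ, ω : ℝ³ \ axis ν → S²` are smooth, `θ(p), ω(p), p` are pairwise orthogonal, and
`ω(p) = p × θ(p) / |p|`. Values on `axis ν` are irrelevant. -/
structure IsFrame (ν : E3) (θ ω : E3 → E3) : Prop where
  smooth_θ : ContDiffOn ℝ ((⊤ : ℕ∞) : WithTop ℕ∞) θ (axis ν)ᶜ
  smooth_ω : ContDiffOn ℝ ((⊤ : ℕ∞) : WithTop ℕ∞) ω (axis ν)ᶜ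
  norm_θ : ∀ p ∈ (axis ν)ᶜ, ‖θ p‖ = 1
  norm_ω : ∀ p ∈ (axis ν)ᶜ, ‖ω p‖ = 1
  orth_θ : ∀ p ∈ (axis ν)ᶜ, inner ℝ (θ p) p = 0
  orth_ω : ∀ p ∈ (axis ν)ᶜ, inner ℝ (ω p) p = 0
  orth_θω : ∀ p ∈ (axis ν)ᶜ, inner ℝ (θ p) (ω p) = 0
  orientation : ∀ p ∈ (axis ν)ᶜ, ω p = (1 / ‖p‖) • cross p (θ p)

/-- `k(λ, p) = κ₁ θ(p) + κ₂ ω(p) + p / 2 ∈ ℂ³`, with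
`κ₁ = (i |p| / 4) (λ + 1/λ)` and `κ₂ = (|p| / 4) (λ - 1/λ)`. -/
def kvec (θ ω : E3 → E3) (z : ℂ) (p : E3) : Fin 3 → ℂ := fun j =>
  (Complex.I * (‖p‖ : ℂ) / 4 * (z + 1 / z)) * ((θ p j : ℝ) : ℂ)
    + ((‖p‖ : ℂ) / 4 * (z - 1 / z)) * ((ω p j : ℝ) : ℂ) + ((p j : ℝ) : ℂ) / 2

/-- The coordinate `λ(k, p) = 2 k · (θ(p) + i ω(p)) / (i |p|)`. -/
def lam (θ ω : E3 → E3) (k : Fin 3 → ℂ) (p : E3) : ℂ :=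
  2 * (∑ j, k j * (((θ p j : ℝ) : ℂ) + Complex.I * ((ω p j : ℝ) : ℂ)))
    / (Complex.I * (‖p‖ : ℂ))

/-- The real part of a vector of `ℂ³`. -/
def reVec (k : Fin 3 → ℂ) : E3 := WithLp.toLp 2 fun j => (k j).re

/-- The imaginary part of a vector of `ℂ³`. -/
def imVec (k : Fin 3 → ℂ) : E3 := WithLp.toLp 2 fun j => (k j).im

/-- `k^⊥ = (Im k × Re k) / |Im k|`. -/
def kperp (k : Fin 3 → ℂ) : E3 := (1 / ‖imVec k‖) • cross (imVec k) (reVec k)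

/-- `ξ = Re k (cos φ - 1) + k^⊥ sin φ`, as a function of `k` and `φ`. -/
def xi (k : Fin 3 → ℂ) (φ : ℝ) : E3 :=
  (Real.cos φ - 1) • reVec k + Real.sin φ • kperp k

/-- The translate `k + ξ` of `k ∈ ℂ³` by `ξ ∈ ℝ³`. -/
def shift (k : Fin 3 → ℂ) (ξ : E3) : Fin 3 → ℂ := fun j => k j + ((ξ j : ℝ) : ℂ)

/-- The integrand (in `φ`) of `{V₁, V₂}(λ, p)`, for functions `V₁, V₂` of `(k, p)`. -/
def braceIntegrand (θ ω : E3 → E3) (V₁ V₂ : (Fin 3 → ℂ) → E3 → ℂ) (x : ℂ × E3) (φ : ℝ) : ℂ :=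
  ((‖x.2‖ : ℂ) / 2 * (((‖x.1‖ : ℂ) ^ 2 - 1) / (starRingEnd ℂ x.1 * (‖x.1‖ : ℂ)))
        * ((Real.cos φ - 1 : ℝ) : ℂ)
      - (‖x.2‖ : ℂ) / starRingEnd ℂ x.1 * ((Real.sin φ : ℝ) : ℂ))
    * V₁ (kvec θ ω x.1 x.2) (-xi (kvec θ ω x.1 x.2) φ)
    * V₂ (shift (kvec θ ω x.1 x.2) (xi (kvec θ ω x.1 x.2) φ)) (x.2 + xi (kvec θ ω x.1 x.2) φ)

/-- `{V₁, V₂}(λ, p)`, for functions `V₁, V₂` of `(k, p)`. -/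
def brace (θ ω : E3 → E3) (V₁ V₂ : (Fin 3 → ℂ) → E3 → ℂ) (x : ℂ × E3) : ℂ :=
  -((Real.pi : ℂ) / 4) * ∫ φ in (-Real.pi)..Real.pi, braceIntegrand θ ω V₁ V₂ x φ

/-- `U'(k, p) = U(λ(k, p), p)`. -/
def lift (θ ω : E3 → E3) (U : ℂ × E3 → ℂ) : (Fin 3 → ℂ) → E3 → ℂ :=
  fun k p => U (lam θ ω k p, p)

/-- `(U₁, U₂)(ζ, p) = {U₁', U₂'}(ζ, p)`. -/
def pair (θ ω : E3 → E3) (U₁ U₂ : ℂ × E3 → ℂ) (x : ℂ × E3) : ℂ :=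
  brace θ ω (lift θ ω U₁) (lift θ ω U₂) x

/-- `I(U₁, U₂)(λ, p) = -(1/π) ∫_ℂ (U₁, U₂)(ζ, p) / (ζ - λ) d Re ζ d Im ζ`. -/
def opI (θ ω : E3 → E3) (U₁ U₂ : ℂ × E3 → ℂ) (x : ℂ × E3) : ℂ :=
  -(1 / (Real.pi : ℂ)) * ∫ ζ : ℂ, pair θ ω U₁ U₂ (ζ, x.2) / (ζ - x.1)

/-- `N(U) = I(U, U)`. -/
def opN (θ ω : E3 → E3) (U : ℂ × E3 → ℂ) : ℂ × E3 → ℂ := opI θ ω U U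

/-- `M(U)(λ, p) = -(1/π) ∫_ℂ (U, U)(ζ, p) (1 / (ζ - λ) - 1 / (ζ - λ₀(p))) d Re ζ d Im ζ`. -/
def opM (θ ω : E3 → E3) (lam₀ : E3 → ℂ) (U : ℂ × E3 → ℂ) (x : ℂ × E3) : ℂ :=
  -(1 / (Real.pi : ℂ)) *
    ∫ ζ : ℂ, pair θ ω U U (ζ, x.2) * (1 / (ζ - x.1) - 1 / (ζ - lam₀ x.2))

/-- `|||U|||_μ = ess sup (1 + |p|)^μ |U(λ, p)|` over `dom ν`, as an extended number. -/
def eWNorm (ν : E3) (μ : ℝ) (U : ℂ × E3 → ℂ) : ENNReal :=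
  eLpNorm (fun x => (((1 + ‖x.2‖) ^ μ : ℝ) : ℂ) * U x) ⊤ (volume.restrict (dom ν))

/-- `|||U|||_μ` as a real number (the genuine value when it is finite). -/
def wNorm (ν : E3) (μ : ℝ) (U : ℂ × E3 → ℂ) : ℝ := (eWNorm ν μ U).toReal

/-- Membership (of the class of `U`) in `L^∞_μ((ℂ \ 0) × (ℝ³ \ axis ν))`. -/
def MemW (ν : E3) (μ : ℝ) (U : ℂ × E3 → ℂ) : Prop :=
  MemLp U ⊤ (volume.restrict (dom ν)) ∧ eWNorm ν μ U < ⊤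

/-- For almost every `p`, the function `F(·, p)` lies in `C(ℂ \ 0) ∩ L^∞(ℂ \ 0)`. -/
def SliceContBdd (ν : E3) (F : ℂ × E3 → ℂ) : Prop :=
  ∀ᵐ p ∂(volume.restrict (axis ν)ᶜ),
    ContinuousOn (fun z => F (z, p)) {0}ᶜ ∧
      MemLp (fun z => F (z, p)) ⊤ (volume.restrict ({0}ᶜ : Set ℂ))

/-- Equality almost everywhere on `dom ν`. -/
def EqDom (ν : E3) (F G : ℂ × E3 → ℂ) : Prop := F =ᵐ[volume.restrict (dom ν)] G

/-- For almost every `p`, equality of `F(λ, p)` and `G(λ, p)` for every `λ ≠ 0`. -/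
def EqSlices (ν : E3) (F G : ℂ × E3 → ℂ) : Prop :=
  ∀ᵐ p ∂(volume.restrict (axis ν)ᶜ), ∀ z : ℂ, z ≠ 0 → F (z, p) = G (z, p)

/-- `U` lies in the closed ball of radius `r` of `L^∞_μ` and solves `U = U₀ + M(U)` there. -/
def IsBallSolution (ν : E3) (μ : ℝ) (θ ω : E3 → E3) (lam₀ : E3 → ℂ) (r : ℝ)
    (U₀ U : ℂ × E3 → ℂ) : Prop :=
  MemW ν μ U ∧ wNorm ν μ U ≤ r ∧ EqDom ν U (U₀ + opM θ ω lam₀ U)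

end FaddeevInverse

end

open FaddeevInverse

/-!
For `k = a + i b` with `k · k = 0` the vectors `a, b` are orthogonal of equal length `ρ`, and the
`p` with `p · p = 2 k · p` form the circle of radius `ρ` about `a` in the plane orthogonal to `b`.
It is parametrised by `φ ↦ -ξ(k, φ)`, and `p` itself has the parameter `4 arctan |λ|`
(`xi_four_arctan`). Hence `-ξ` lies on the same circle, and translation by `ξ` turns `(k, p)` into
another point of the variety, with `Re k` rotated by `φ`.

*Decay.* With `x = |ξ|`, `y = |p + ξ|`, the scalar weight in the integrand of `(U₁, U₂)` has modulus
`4 x y / (|p| (1 + |λ|²))` (`norm_coeff`). Since `x + y ≥ |p|` and `x, y` are at most the diameter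
of the circle, this gives (`integrand_bound`)
`|(U₁, U₂)(ζ, p)| ≤ C (1 + |p|)^(-μ) (w_s(ζ) + w_{1/s}(ζ))`, where `w_s(ζ) = s / (1 + s² |ζ|²)` and
`s = min (|p|, 1)`. The integral of `w_s(ζ) / |ζ - λ|` is invariant under the scaling
`ζ ↦ s ζ`, `λ ↦ s λ`, so it is bounded uniformly in `s` and `λ`
(`exists_planeWeight_integral_bound`); this is the source of the constant. The estimate
`|1/u - 1/v| ≤ 2 |u - v|^(1/2) (|u|^(-3/2) + |v|^(-3/2))` makes the Cauchy transform Hölder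
continuous in `λ` (`continuous_cauchyTransform`).

*Null sets.* For the quadratic expression to make sense on classes of functions, the substitutions
`(λ, p, φ) ↦ (k, -ξ)` and `(λ, p, φ) ↦ (k + ξ, p + ξ)` have to pull null sets back to null sets.
The second one is inverted, for fixed `φ`, by the same map with `-φ`. The first one becomes
invertible once the parameter `4 arctan |λ|` of `p` is recorded, and up to multiples of `2π` its
inverse has the same form, since `p` and `-ξ` are points of one circle. The inverses are
differentiable, so they map null sets to null sets (`volume_firstDom_inter_preimage`,
`volume_secondDom_inter_preimage`). The angles and momenta for which one of the vectors `ξ`,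
`p + ξ` lies on the axis, where there is no frame, are negligible (`ae_mem_firstDom_secondDom`).

Bilinearity and the bound for `I` give the Lipschitz bounds, and the assertions about small data
follow from the contraction principle (`exists_fixedPoint`).
-/

namespace FaddeevInverse

/-! ### The vector product -/

lemma inner_coord (a b : E3) : inner ℝ a b = a 0 * b 0 + a 1 * b 1 + a 2 * b 2 := by
  simp [PiLp.inner_apply, Fin.sum_univ_three]
  ring

lemma cross_zero_apply (a b : E3) : cross a b 0 = a 1 * b 2 - a 2 * b 1 := by
  simp [cross, cross_apply]

lemma cross_one_apply (a b : E3) : cross a b 1 = a 2 * b 0 - a 0 * b 2 := by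
  simp [cross, cross_apply]

lemma cross_two_apply (a b : E3) : cross a b 2 = a 0 * b 1 - a 1 * b 0 := by
  simp [cross, cross_apply]

lemma E3_ext {a b : E3} (h0 : a 0 = b 0) (h1 : a 1 = b 1) (h2 : a 2 = b 2) : a = b := by
  ext i
  fin_cases i <;> assumption

lemma cross_add_right (a b c : E3) : cross a (b + c) = cross a b + cross a c := by
  simp [cross]

lemma cross_smul_right (t : ℝ) (a b : E3) : cross a (t • b) = t • cross a b := by
  simp [cross]

lemma cross_add_left (a b c : E3) : cross (a + b) c = cross a c + cross b c := by
  simp [cross]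

lemma cross_smul_left (t : ℝ) (a b : E3) : cross (t • a) b = t • cross a b := by
  simp [cross]

lemma cross_self_eq_zero (a : E3) : cross a a = 0 := by
  simp [cross]

lemma cross_swap (a b : E3) : cross b a = -cross a b := by
  apply E3_ext <;> simp [cross_zero_apply, cross_one_apply, cross_two_apply] <;> ring

lemma inner_cross_left (a b : E3) : inner ℝ a (cross a b) = 0 := by
  rw [inner_coord, cross_zero_apply, cross_one_apply, cross_two_apply]; ring

lemma inner_cross_right (a b : E3) : inner ℝ b (cross a b) = 0 := by
  rw [inner_coord, cross_zero_apply, cross_one_apply, cross_two_apply]; ring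

lemma cross_cross_right (a b c : E3) :
    cross a (cross b c) = (inner ℝ a c : ℝ) • b - (inner ℝ a b : ℝ) • c := by
  simp only [inner_coord]
  apply E3_ext <;> simp [cross_zero_apply, cross_one_apply, cross_two_apply] <;> ring

lemma inner_cross_cross (a b : E3) :
    inner ℝ (cross a b) (cross a b)
      = (inner ℝ a a : ℝ) * inner ℝ b b - (inner ℝ a b : ℝ) ^ 2 := by
  simp only [inner_coord, cross_zero_apply, cross_one_apply, cross_two_apply]; ring

/-! ### Orthogonal frames attached to a nonzero vector -/

/-- `(p / |p|, t, o)` is a positively oriented orthonormal basis of `ℝ³`. -/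
structure FrameAt (p t o : E3) : Prop where
  ne_zero : p ≠ 0
  tt : inner ℝ t t = (1 : ℝ)
  oo : inner ℝ o o = (1 : ℝ)
  tp : inner ℝ t p = (0 : ℝ)
  op : inner ℝ o p = (0 : ℝ)
  t_o : inner ℝ t o = (0 : ℝ)
  cross_pt : cross p t = ‖p‖ • o

lemma zero_mem_axis (ν : E3) : (0 : E3) ∈ axis ν := ⟨0, by simp⟩

lemma ne_zero_of_notMem_axis {ν p : E3} (hp : p ∉ axis ν) : p ≠ 0 := by
  rintro rfl
  exact hp (zero_mem_axis ν)

lemma IsFrame.frameAt {ν : E3} {θ ω : E3 → E3} (h : IsFrame ν θ ω) {p : E3} (hp : p ∉ axis ν) :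
    FrameAt p (θ p) (ω p) := by
  have hp0 := ne_zero_of_notMem_axis hp
  refine ⟨hp0, ?_, ?_, h.orth_θ p hp, h.orth_ω p hp, h.orth_θω p hp, ?_⟩
  · rw [real_inner_self_eq_norm_sq, h.norm_θ p hp, one_pow]
  · rw [real_inner_self_eq_norm_sq, h.norm_ω p hp, one_pow]
  · rw [h.orientation p hp, smul_smul, mul_one_div_cancel (norm_ne_zero_iff.2 hp0), one_smul]

namespace FrameAt

variable {p t o : E3} (h : FrameAt p t o)
include h

lemma norm_pos : 0 < ‖p‖ := norm_pos_iff.2 h.ne_zero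

lemma cross_po : cross p o = -(‖p‖ • t) := by
  have hP := h.norm_pos.ne'
  have h1 : ‖p‖ • cross p o = cross p (cross p t) := by rw [h.cross_pt, cross_smul_right]
  rw [cross_cross_right, real_inner_comm, h.tp, real_inner_self_eq_norm_sq] at h1
  have h2 : ‖p‖ • cross p o = ‖p‖ • (-(‖p‖ • t)) := by
    rw [h1]; module
  exact smul_right_injective _ hP h2

lemma cross_to : cross t o = (1 / ‖p‖) • p := by
  have hP := h.norm_pos.ne'
  have h1 : ‖p‖ • cross t o = cross t (cross p t) := by rw [h.cross_pt, cross_smul_right]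
  rw [cross_cross_right, h.tp, h.tt] at h1
  have h2 : ‖p‖ • cross t o = ‖p‖ • ((1 / ‖p‖) • p) := by
    rw [h1, smul_smul, mul_one_div_cancel hP]; module
  exact smul_right_injective _ hP h2

lemma expand (v : E3) :
    v = (inner ℝ v p / ‖p‖ ^ 2 : ℝ) • p + (inner ℝ v t : ℝ) • t + (inner ℝ v o : ℝ) • o := by
  have hP := h.norm_pos.ne'
  set w := v - ((inner ℝ v p / ‖p‖ ^ 2 : ℝ) • p + (inner ℝ v t : ℝ) • t
    + (inner ℝ v o : ℝ) • o) with hw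
  have pt : inner ℝ p t = (0 : ℝ) := by rw [real_inner_comm]; exact h.tp
  have po : inner ℝ p o = (0 : ℝ) := by rw [real_inner_comm]; exact h.op
  have ot : inner ℝ o t = (0 : ℝ) := by rw [real_inner_comm]; exact h.t_o
  have pp : inner ℝ p p = ‖p‖ ^ 2 := real_inner_self_eq_norm_sq p
  have w1 : inner ℝ w p = (0 : ℝ) := by
    rw [hw]
    simp only [inner_sub_left, inner_add_left, real_inner_smul_left, h.tp, h.op, pp]
    field_simp
    ring
  have w2 : inner ℝ w t = (0 : ℝ) := by
    rw [hw]
    simp only [inner_sub_left, inner_add_left, real_inner_smul_left, h.tt, ot, pt]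
    ring
  have w3 : inner ℝ w o = (0 : ℝ) := by
    rw [hw]
    simp only [inner_sub_left, inner_add_left, real_inner_smul_left, h.t_o, h.oo, po]
    ring
  -- `w` is both parallel and orthogonal to `p × t`
  have c0 : cross w o = 0 := by
    have : ‖p‖ • cross w o = 0 := by
      rw [← cross_smul_right, ← h.cross_pt, cross_cross_right, w1, w2]; simp
    simpa [hP] using this
  have key := inner_cross_cross w o
  rw [c0, w3, h.oo] at key
  have : w = 0 := by
    rw [← inner_self_eq_zero (𝕜 := ℝ)]
    simpa using key.symm
  exact sub_eq_zero.1 this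

lemma inner_eq (v w : E3) : inner ℝ v w
    = (inner ℝ v p : ℝ) * inner ℝ w p / ‖p‖ ^ 2 + (inner ℝ v t : ℝ) * inner ℝ w t
      + (inner ℝ v o : ℝ) * inner ℝ w o := by
  conv_lhs => rw [h.expand v]
  simp only [inner_add_left, real_inner_smul_left]
  rw [real_inner_comm w p, real_inner_comm w t, real_inner_comm w o]
  ring

end FrameAt

/-! ### The vectors `k(λ, p)` and their circles -/

lemma reVec_apply (k : Fin 3 → ℂ) (j : Fin 3) : reVec k j = (k j).re := rfl

lemma imVec_apply (k : Fin 3 → ℂ) (j : Fin 3) : imVec k j = (k j).im := rfl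

/-- The pair `(k, p)` satisfies `k · k = 0` and `p · p = 2 k · p`, written in terms of real and
imaginary parts, and `k ≠ 0`. -/
structure OnVariety (k : Fin 3 → ℂ) (p : E3) : Prop where
  im_ne_zero : imVec k ≠ 0
  re_im : inner ℝ (reVec k) (imVec k) = (0 : ℝ)
  re_re : inner ℝ (reVec k) (reVec k) = (inner ℝ (imVec k) (imVec k) : ℝ)
  im_p : inner ℝ (imVec k) p = (0 : ℝ)
  p_p : inner ℝ p p = 2 * (inner ℝ (reVec k) p : ℝ)

/-- The unnormalised direction `-Im λ · θ + Re λ · ω` of the component of `Re k(λ, p)`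
orthogonal to `p`. -/
def mdir (θ ω : E3 → E3) (z : ℂ) (p : E3) : E3 := (-z.im) • θ p + z.re • ω p

section kvec

variable {θ ω : E3 → E3} {z : ℂ} {p : E3}

lemma re_one_div (z : ℂ) : (1 / z).re = z.re / ‖z‖ ^ 2 := by
  rw [one_div, Complex.inv_re, Complex.normSq_eq_norm_sq]

lemma im_one_div (z : ℂ) : (1 / z).im = -z.im / ‖z‖ ^ 2 := by
  rw [one_div, Complex.inv_im, Complex.normSq_eq_norm_sq]

lemma kvec_coeff_θ (P : ℝ) (z : ℂ) : Complex.I * (P : ℂ) / 4 * (z + 1 / z)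
    = ((-(P / 4 * z.im * (1 - 1 / ‖z‖ ^ 2)) : ℝ) : ℂ)
      + ((P / 4 * z.re * (1 + 1 / ‖z‖ ^ 2) : ℝ) : ℂ) * Complex.I := by
  have : Complex.I * (P : ℂ) / 4 = ((P / 4 : ℝ) : ℂ) * Complex.I := by push_cast; ring
  rw [this]
  apply Complex.ext
  · simp only [Complex.mul_re, Complex.mul_im, Complex.add_re, Complex.add_im, Complex.ofReal_re,
      Complex.ofReal_im, Complex.I_re, Complex.I_im, re_one_div, im_one_div]
    ring
  · simp only [Complex.mul_re, Complex.mul_im, Complex.add_re, Complex.add_im, Complex.ofReal_re,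
      Complex.ofReal_im, Complex.I_re, Complex.I_im, re_one_div, im_one_div]
    ring

lemma kvec_coeff_ω (P : ℝ) (z : ℂ) : (P : ℂ) / 4 * (z - 1 / z)
    = ((P / 4 * z.re * (1 - 1 / ‖z‖ ^ 2) : ℝ) : ℂ)
      + ((P / 4 * z.im * (1 + 1 / ‖z‖ ^ 2) : ℝ) : ℂ) * Complex.I := by
  have : (P : ℂ) / 4 = ((P / 4 : ℝ) : ℂ) := by push_cast; ring
  rw [this]
  apply Complex.ext
  · simp only [Complex.mul_re, Complex.add_re, Complex.sub_re,
      Complex.sub_im, Complex.ofReal_re,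
      Complex.ofReal_im, Complex.I_re, Complex.I_im, re_one_div, im_one_div]
    ring
  · simp only [Complex.mul_im, Complex.add_im, Complex.sub_re,
      Complex.sub_im, Complex.ofReal_re,
      Complex.ofReal_im, Complex.I_re, Complex.I_im, re_one_div, im_one_div]
    ring

lemma reVec_kvec : reVec (kvec θ ω z p)
    = (1 / 2 : ℝ) • p + (‖p‖ / 4 * (1 - 1 / ‖z‖ ^ 2)) • mdir θ ω z p := by
  ext j
  have : ((p j : ℝ) : ℂ) / 2 = ((p j / 2 : ℝ) : ℂ) := by push_cast; ring
  rw [reVec_apply, kvec, kvec_coeff_θ, kvec_coeff_ω, this]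
  simp only [mdir, Complex.add_re, Complex.re_mul_ofReal, Complex.re_ofReal_mul, Complex.ofReal_re,
    Complex.I_re, PiLp.add_apply, PiLp.smul_apply, smul_eq_mul]
  ring

lemma imVec_kvec : imVec (kvec θ ω z p)
    = (‖p‖ / 4 * (1 + 1 / ‖z‖ ^ 2)) • (z.re • θ p + z.im • ω p) := by
  ext j
  have : ((p j : ℝ) : ℂ) / 2 = ((p j / 2 : ℝ) : ℂ) := by push_cast; ring
  rw [imVec_apply, kvec, kvec_coeff_θ, kvec_coeff_ω, this]
  simp only [Complex.add_im, Complex.im_mul_ofReal, Complex.im_ofReal_mul, Complex.ofReal_im,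
    Complex.I_im, PiLp.add_apply, PiLp.smul_apply, smul_eq_mul]
  ring

variable (h : FrameAt p (θ p) (ω p))
include h

lemma inner_mdir_self : inner ℝ (mdir θ ω z p) (mdir θ ω z p) = ‖z‖ ^ 2 := by
  have ot : inner ℝ (ω p) (θ p) = (0 : ℝ) := by rw [real_inner_comm]; exact h.t_o
  simp only [mdir, inner_add_left, inner_add_right, real_inner_smul_left, real_inner_smul_right,
    h.tt, h.oo, h.t_o, ot]
  rw [← Complex.normSq_eq_norm_sq, Complex.normSq_apply]
  ring

lemma inner_mdir_p : inner ℝ (mdir θ ω z p) p = (0 : ℝ) := by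
  simp [mdir, inner_add_left, real_inner_smul_left, h.tp, h.op]

lemma inner_ndir_self :
    inner ℝ (z.re • θ p + z.im • ω p) (z.re • θ p + z.im • ω p) = ‖z‖ ^ 2 := by
  have ot : inner ℝ (ω p) (θ p) = (0 : ℝ) := by rw [real_inner_comm]; exact h.t_o
  simp only [inner_add_left, inner_add_right, real_inner_smul_left, real_inner_smul_right,
    h.tt, h.oo, h.t_o, ot]
  rw [← Complex.normSq_eq_norm_sq, Complex.normSq_apply]
  ring

lemma norm_imVec_kvec : ‖imVec (kvec θ ω z p)‖ = ‖p‖ / 4 * (1 + 1 / ‖z‖ ^ 2) * ‖z‖ := by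
  have h2 : ‖z.re • θ p + z.im • ω p‖ = ‖z‖ := by
    have := inner_ndir_self (z := z) h
    rw [real_inner_self_eq_norm_sq] at this
    exact (sq_eq_sq₀ (norm_nonneg _) (norm_nonneg _)).1 this
  rw [imVec_kvec, norm_smul, h2, Real.norm_of_nonneg (by positivity)]

/-- The second radius vector of the circle of `k(λ, p)`, in the basis `p`, `mdir`. -/
lemma kperp_kvec (hz : z ≠ 0) : kperp (kvec θ ω z p)
    = (-(‖p‖ / (2 * ‖z‖))) • mdir θ ω z p + ((‖z‖ - 1 / ‖z‖) / 4) • p := by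
  have hr : ‖z‖ ≠ 0 := norm_ne_zero_iff.2 hz
  have hP := h.norm_pos.ne'
  have e1 : cross (z.re • θ p + z.im • ω p) p = (-‖p‖) • mdir θ ω z p := by
    rw [cross_swap, cross_add_right, cross_smul_right, cross_smul_right, h.cross_pt, h.cross_po,
      mdir]
    module
  have e2 : cross (z.re • θ p + z.im • ω p) (mdir θ ω z p) = (‖z‖ ^ 2 / ‖p‖) • p := by
    have : cross (ω p) (θ p) = -((1 / ‖p‖) • p) := by rw [cross_swap, h.cross_to]
    simp only [mdir, cross_add_right, cross_add_left, cross_smul_right, cross_smul_left,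
      cross_self_eq_zero, h.cross_to, this]
    rw [← Complex.normSq_eq_norm_sq, Complex.normSq_apply]
    module
  rw [kperp, norm_imVec_kvec h, reVec_kvec, imVec_kvec, cross_smul_left, cross_add_right,
    cross_smul_right, cross_smul_right, e1, e2, smul_smul]
  have e3 : 1 / (‖p‖ / 4 * (1 + 1 / ‖z‖ ^ 2) * ‖z‖) * (‖p‖ / 4 * (1 + 1 / ‖z‖ ^ 2))
      = 1 / ‖z‖ := by
    have : 1 + 1 / ‖z‖ ^ 2 ≠ 0 := by positivity
    field_simp
  rw [e3, smul_add, smul_smul, smul_smul, smul_smul, smul_smul]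
  congr 2
  · field_simp
  · field_simp

lemma onVariety_kvec (hz : z ≠ 0) : OnVariety (kvec θ ω z p) p := by
  have hr : ‖z‖ ≠ 0 := norm_ne_zero_iff.2 hz
  have hP := h.norm_pos
  have ot : inner ℝ (ω p) (θ p) = (0 : ℝ) := by rw [real_inner_comm]; exact h.t_o
  have pt : inner ℝ p (θ p) = (0 : ℝ) := by rw [real_inner_comm]; exact h.tp
  have po : inner ℝ p (ω p) = (0 : ℝ) := by rw [real_inner_comm]; exact h.op
  have pm : inner ℝ p (mdir θ ω z p) = (0 : ℝ) := by rw [real_inner_comm]; exact inner_mdir_p h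
  have mn : inner ℝ (mdir θ ω z p) (z.re • θ p + z.im • ω p) = (0 : ℝ) := by
    simp only [mdir, inner_add_left, inner_add_right, real_inner_smul_left, real_inner_smul_right,
      h.tt, h.oo, h.t_o, ot]
    ring
  have pn : inner ℝ p (z.re • θ p + z.im • ω p) = (0 : ℝ) := by
    simp [inner_add_right, real_inner_smul_right, pt, po]
  refine ⟨?_, ?_, ?_, ?_, ?_⟩
  · rw [← norm_ne_zero_iff, norm_imVec_kvec h]
    positivity
  · rw [reVec_kvec, imVec_kvec]
    simp only [real_inner_smul_right, inner_add_left, real_inner_smul_left, mn, pn]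
    ring
  · rw [reVec_kvec, imVec_kvec]
    simp only [real_inner_smul_right, real_inner_smul_left, inner_add_left (_ • p),
      inner_add_right _ (_ • p), inner_ndir_self h, pm,
      inner_mdir_self h, inner_mdir_p h, real_inner_self_eq_norm_sq p]
    field_simp
    ring
  · rw [imVec_kvec, real_inner_smul_left, real_inner_comm, pn, mul_zero]
  · rw [reVec_kvec, inner_add_left, real_inner_smul_left, real_inner_smul_left, inner_mdir_p h]
    ring

end kvec

section variety

variable {θ ω : E3 → E3} {k : Fin 3 → ℂ} {p : E3}

lemma lam_eq (θ ω : E3 → E3) (k : Fin 3 → ℂ) (p : E3) : lam θ ω k p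
    = 2 * ((((inner ℝ (reVec k) (θ p) : ℝ) : ℂ) + Complex.I * ((inner ℝ (imVec k) (θ p) : ℝ) : ℂ))
        + Complex.I * (((inner ℝ (reVec k) (ω p) : ℝ) : ℂ)
            + Complex.I * ((inner ℝ (imVec k) (ω p) : ℝ) : ℂ))) / (Complex.I * (‖p‖ : ℂ)) := by
  have hk : ∀ j, k j = ((reVec k j : ℝ) : ℂ) + Complex.I * ((imVec k j : ℝ) : ℂ) := by
    intro j
    rw [reVec_apply, imVec_apply, mul_comm]
    exact (Complex.re_add_im _).symm
  rw [lam]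
  congr 2
  rw [Fin.sum_univ_three, hk 0, hk 1, hk 2]
  simp only [inner_coord]
  push_cast
  ring

lemma kvec_apply (θ ω : E3 → E3) (z : ℂ) (p : E3) (j : Fin 3) : kvec θ ω z p j
    = (Complex.I * (‖p‖ : ℂ) / 4 * (z + 1 / z)) * ((θ p j : ℝ) : ℂ)
    + ((‖p‖ : ℂ) / 4 * (z - 1 / z)) * ((ω p j : ℝ) : ℂ) + ((p j : ℝ) : ℂ) / 2 := rfl

/-- `λ ↦ k(λ, p)` is inverted by the coordinate `λ(·, p)`. -/
lemma lam_kvec (h : FrameAt p (θ p) (ω p)) (z : ℂ) :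
    lam θ ω (kvec θ ω z p) p = z := by
  have hP : (‖p‖ : ℂ) ≠ 0 := by exact_mod_cast h.norm_pos.ne'
  have c1 := h.tt
  have c2 := h.oo
  have c3 := h.tp
  have c4 := h.op
  have c5 := h.t_o
  rw [inner_coord] at c1 c2 c3 c4 c5
  have d1 := congrArg (fun x : ℝ => (x : ℂ)) c1
  have d2 := congrArg (fun x : ℝ => (x : ℂ)) c2
  have d3 := congrArg (fun x : ℝ => (x : ℂ)) c3
  have d4 := congrArg (fun x : ℝ => (x : ℂ)) c4
  have d5 := congrArg (fun x : ℝ => (x : ℂ)) c5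
  push_cast at d1 d2 d3 d4 d5
  rw [lam, div_eq_iff (mul_ne_zero Complex.I_ne_zero hP), Fin.sum_univ_three]
  simp only [kvec_apply]
  set A := Complex.I * (‖p‖ : ℂ) / 4 * (z + 1 / z) with hA
  set B := (‖p‖ : ℂ) / 4 * (z - 1 / z) with hB
  have e : A + Complex.I * B = Complex.I * ‖p‖ / 2 * z := by
    rw [hA, hB]; ring
  have hI := Complex.I_mul_I
  linear_combination 2 * A * d1 + 2 * Complex.I * B * d2 + d3 + Complex.I * d4
    + 2 * (Complex.I * A + B) * d5 + 2 * e

/-- `λ(·, p)` is a coordinate on the set of all `k` with `(k, p)` in the variety: the component of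
`k` orthogonal to `p` is determined by its two products with `θ ± i ω`, which are reciprocal up to
the factor `-|p|² / 4`. -/
lemma OnVariety.lam_spec (hk : OnVariety k p) (h : FrameAt p (θ p) (ω p)) :
    lam θ ω k p ≠ 0 ∧ kvec θ ω (lam θ ω k p) p = k := by
  have hPr : ‖p‖ ≠ 0 := h.norm_pos.ne'
  have hP : (‖p‖ : ℂ) ≠ 0 := by exact_mod_cast hPr
  have hI := Complex.I_ne_zero
  have hII := Complex.I_mul_I
  have pp : inner ℝ p p = ‖p‖ ^ 2 := real_inner_self_eq_norm_sq p
  have hap : inner ℝ (reVec k) p = ‖p‖ ^ 2 / 2 := by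
    have := hk.p_p
    linarith
  have e1 := h.inner_eq (reVec k) (reVec k)
  have e2 := h.inner_eq (imVec k) (imVec k)
  have e3 := h.inner_eq (reVec k) (imVec k)
  have x1 := h.expand (reVec k)
  have x2 := h.expand (imVec k)
  rw [hk.re_re, hap] at e1
  rw [hk.im_p] at e2 e3
  rw [hk.re_im] at e3
  rw [hap] at x1
  rw [hk.im_p] at x2
  have hlam := lam_eq θ ω k p
  set a1 : ℝ := inner ℝ (reVec k) (θ p)
  set a2 : ℝ := inner ℝ (reVec k) (ω p)
  set b1 : ℝ := inner ℝ (imVec k) (θ p)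
  set b2 : ℝ := inner ℝ (imVec k) (ω p)
  have r1 : a1 ^ 2 + a2 ^ 2 - b1 ^ 2 - b2 ^ 2 = -‖p‖ ^ 2 / 4 := by
    have : ‖p‖ ^ 2 / 2 * (‖p‖ ^ 2 / 2) / ‖p‖ ^ 2 = ‖p‖ ^ 2 / 4 := by field_simp; norm_num
    rw [this] at e1
    rw [zero_mul, zero_div] at e2
    linarith
  have r2 : a1 * b1 + a2 * b2 = 0 := by
    rw [mul_zero, zero_div] at e3
    linarith
  set u : ℂ := (a1 : ℂ) + Complex.I * b1 with hu
  set v : ℂ := (a2 : ℂ) + Complex.I * b2 with hv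
  have huv : (u + Complex.I * v) * (u - Complex.I * v) = -(‖p‖ : ℂ) ^ 2 / 4 := by
    have r1c := congrArg (fun x : ℝ => (x : ℂ)) r1
    have r2c := congrArg (fun x : ℝ => (x : ℂ)) r2
    push_cast at r1c r2c
    rw [hu, hv]
    linear_combination r1c + 2 * Complex.I * r2c +
      ((b1 : ℂ) ^ 2 - ((a2 : ℂ) + Complex.I * b2) ^ 2 + (b2 : ℂ) ^ 2) * hII
  have hne : u + Complex.I * v ≠ 0 := by
    intro h0
    rw [h0, zero_mul] at huv
    have : (‖p‖ : ℂ) ^ 2 = 0 := by linear_combination 4 * huv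
    exact hP (pow_eq_zero_iff (two_ne_zero) |>.1 this)
  have hl0 : lam θ ω k p ≠ 0 := by
    rw [hlam]
    exact div_ne_zero (mul_ne_zero two_ne_zero hne) (mul_ne_zero hI hP)
  refine ⟨hl0, ?_⟩
  have hinv : 1 / lam θ ω k p = 2 * (u - Complex.I * v) / (Complex.I * ‖p‖) := by
    rw [hlam, one_div_div, div_eq_div_iff (mul_ne_zero two_ne_zero hne) (mul_ne_zero hI hP)]
    linear_combination (‖p‖ : ℂ) ^ 2 * hII - 4 * huv
  have ct : Complex.I * (‖p‖ : ℂ) / 4 * (lam θ ω k p + 1 / lam θ ω k p) = u := by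
    rw [hinv, hlam]; field_simp; ring
  have co : (‖p‖ : ℂ) / 4 * (lam θ ω k p - 1 / lam θ ω k p) = v := by
    rw [hinv, hlam]; field_simp; ring
  funext j
  rw [kvec_apply, ct, co]
  have y1 := congrArg (fun w : E3 => w j) x1
  have y2 := congrArg (fun w : E3 => w j) x2
  simp only [PiLp.add_apply, PiLp.smul_apply, smul_eq_mul] at y1 y2
  have : ‖p‖ ^ 2 / 2 / ‖p‖ ^ 2 = 1 / 2 := by field_simp
  rw [this] at y1
  have hkj : k j = ((reVec k j : ℝ) : ℂ) + Complex.I * ((imVec k j : ℝ) : ℂ) := by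
    rw [reVec_apply, imVec_apply, mul_comm]
    exact (Complex.re_add_im _).symm
  rw [hkj, y1, y2, hu, hv]
  push_cast
  ring

end variety

/-! ### The circle of a null vector and lengths of momenta -/

section circle

variable {k : Fin 3 → ℂ} {p : E3}

lemma reVec_shift (k : Fin 3 → ℂ) (ξ : E3) : reVec (shift k ξ) = reVec k + ξ := by
  ext j
  simp [reVec_apply, shift]

lemma imVec_shift (k : Fin 3 → ℂ) (ξ : E3) : imVec (shift k ξ) = imVec k := by
  ext j
  simp [imVec_apply, shift]

lemma inner_im_kperp (k : Fin 3 → ℂ) : inner ℝ (imVec k) (kperp k) = (0 : ℝ) := by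
  rw [kperp, real_inner_smul_right, inner_cross_left, mul_zero]

lemma inner_re_kperp (k : Fin 3 → ℂ) : inner ℝ (reVec k) (kperp k) = (0 : ℝ) := by
  rw [kperp, real_inner_smul_right, inner_cross_right, mul_zero]

/-- All the vectors `ξ(k, φ)` lie in the plane orthogonal to `Im k`. -/
lemma OnVariety.inner_im_xi (h : OnVariety k p) (φ : ℝ) :
    inner ℝ (imVec k) (xi k φ) = (0 : ℝ) := by
  rw [xi, inner_add_right, real_inner_smul_right, real_inner_smul_right, inner_im_kperp,
    real_inner_comm, h.re_im]
  ring

lemma inner_re_xi (k : Fin 3 → ℂ) (φ : ℝ) :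
    inner ℝ (reVec k) (xi k φ) = (Real.cos φ - 1) * (inner ℝ (reVec k) (reVec k) : ℝ) := by
  rw [xi, inner_add_right, real_inner_smul_right, real_inner_smul_right, inner_re_kperp]
  ring

lemma OnVariety.kperp_kperp (h : OnVariety k p) :
    inner ℝ (kperp k) (kperp k) = (inner ℝ (reVec k) (reVec k) : ℝ) := by
  have hb : ‖imVec k‖ ≠ 0 := norm_ne_zero_iff.2 h.im_ne_zero
  rw [kperp, real_inner_smul_right, real_inner_smul_left, inner_cross_cross,
    real_inner_comm (reVec k) (imVec k), h.re_im, h.re_re, real_inner_self_eq_norm_sq]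
  field_simp
  ring

lemma OnVariety.xi_xi (h : OnVariety k p) (φ : ℝ) :
    inner ℝ (xi k φ) (xi k φ)
      = 2 * (1 - Real.cos φ) * (inner ℝ (reVec k) (reVec k) : ℝ) := by
  have e : inner ℝ (kperp k) (reVec k) = (0 : ℝ) := by
    rw [real_inner_comm]; exact inner_re_kperp k
  simp only [xi, inner_add_left, inner_add_right, real_inner_smul_left, real_inner_smul_right,
    inner_re_kperp, e, h.kperp_kperp]
  linear_combination (inner ℝ (reVec k) (reVec k) : ℝ) * Real.sin_sq_add_cos_sq φ

/-- The points `-ξ(k, φ)` lie on the circle of all `p` with `(k, p)` in the variety. -/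
lemma OnVariety.neg_xi (h : OnVariety k p) (φ : ℝ) : OnVariety k (-xi k φ) where
  im_ne_zero := h.im_ne_zero
  re_im := h.re_im
  re_re := h.re_re
  im_p := by rw [inner_neg_right, h.inner_im_xi, neg_zero]
  p_p := by rw [inner_neg_neg, h.xi_xi, inner_neg_right, inner_re_xi]; ring

lemma OnVariety.shift (h : OnVariety k p) (φ : ℝ) :
    OnVariety (shift k (xi k φ)) (p + xi k φ) where
  im_ne_zero := by rw [imVec_shift]; exact h.im_ne_zero
  re_im := by
    rw [imVec_shift, reVec_shift, inner_add_left, h.re_im, real_inner_comm, h.inner_im_xi,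
      add_zero]
  re_re := by
    rw [imVec_shift, reVec_shift, inner_add_left, inner_add_right, inner_add_right, h.xi_xi,
      real_inner_comm (reVec k) (xi k φ), inner_re_xi, ← h.re_re]
    ring
  im_p := by rw [imVec_shift, inner_add_right, h.im_p, h.inner_im_xi, add_zero]
  p_p := by
    rw [reVec_shift]
    simp only [inner_add_left, inner_add_right]
    rw [h.xi_xi, h.p_p, inner_re_xi, real_inner_comm p (xi k φ)]
    ring

lemma OnVariety.kperp_shift (h : OnVariety k p) (φ : ℝ) :
    kperp (FaddeevInverse.shift k (xi k φ)) = Real.cos φ • kperp k - Real.sin φ • reVec k := by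
  have hb : ‖imVec k‖ ≠ 0 := norm_ne_zero_iff.2 h.im_ne_zero
  have e1 : cross (imVec k) (kperp k) = -(‖imVec k‖ • reVec k) := by
    rw [kperp, cross_smul_right, cross_cross_right, real_inner_comm, h.re_im,
      real_inner_self_eq_norm_sq, zero_smul, zero_sub, smul_neg, smul_smul]
    congr 2
    field_simp
  have e2 : cross (imVec k) (reVec k) = ‖imVec k‖ • kperp k := by
    rw [kperp, smul_smul, mul_one_div_cancel hb, one_smul]
  rw [kperp, imVec_shift, reVec_shift, xi, cross_add_right, cross_add_right, cross_smul_right,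
    cross_smul_right, e1, e2]
  match_scalars <;> field_simp
  ring

/-- Translating by `ξ(k, φ)` rotates the circle of `k` by the angle `φ`. -/
lemma OnVariety.xi_shift (h : OnVariety k p) (φ : ℝ) :
    xi (FaddeevInverse.shift k (xi k φ)) (-φ) = -xi k φ := by
  rw [xi, h.kperp_shift, reVec_shift, Real.cos_neg, Real.sin_neg]
  simp only [xi]
  have := Real.sin_sq_add_cos_sq φ
  match_scalars
  · linear_combination this
  · ring

lemma shift_shift_neg (k : Fin 3 → ℂ) (ξ : E3) : shift (shift k ξ) (-ξ) = k := by
  funext j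
  simp [shift]

/-- The angle in the parametrisation `φ ↦ -ξ(k, φ)` is determined modulo `2π`. -/
lemma OnVariety.angle_eq (h : OnVariety k p) {φ ψ : ℝ} (he : xi k φ = xi k ψ) :
    ∃ n : ℤ, φ = ψ + 2 * Real.pi * n := by
  have ha : (inner ℝ (reVec k) (reVec k) : ℝ) ≠ 0 := by
    rw [h.re_re]
    exact inner_self_ne_zero.2 h.im_ne_zero
  have hc : Real.cos φ = Real.cos ψ := by
    have := congrArg (fun v => (inner ℝ (reVec k) v : ℝ)) he
    simp only [inner_re_xi] at this
    have := mul_right_cancel₀ ha this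
    linarith
  have hs : Real.sin φ = Real.sin ψ := by
    have := congrArg (fun v => (inner ℝ (kperp k) v : ℝ)) he
    simp only [xi, inner_add_right, real_inner_smul_right, h.kperp_kperp,
      real_inner_comm (reVec k) (kperp k), inner_re_kperp, mul_zero, zero_add] at this
    exact mul_right_cancel₀ ha this
  obtain ⟨n, hn⟩ := Real.Angle.angle_eq_iff_two_pi_dvd_sub.1 (Real.Angle.cos_sin_inj hc hs)
  exact ⟨n, by linarith⟩

end circle

section norms

variable {θ ω : E3 → E3} {z : ℂ} {p : E3}

lemma xi_kvec (h : FrameAt p (θ p) (ω p)) (hz : z ≠ 0) (φ : ℝ) : xi (kvec θ ω z p) φ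
    = ((Real.cos φ - 1) / 2 + Real.sin φ * ((‖z‖ - 1 / ‖z‖) / 4)) • p
      + ((Real.cos φ - 1) * (‖p‖ / 4 * (1 - 1 / ‖z‖ ^ 2)) - Real.sin φ * (‖p‖ / (2 * ‖z‖)))
        • mdir θ ω z p := by
  rw [xi, reVec_kvec, kperp_kvec h hz]
  match_scalars <;> ring

lemma cos_four_arctan (r : ℝ) :
    Real.cos (4 * Real.arctan r) = 1 - 8 * r ^ 2 / (1 + r ^ 2) ^ 2 := by
  have h : 4 * Real.arctan r = 2 * (2 * Real.arctan r) := by ring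
  have hr : 1 + r ^ 2 ≠ 0 := by positivity
  rw [h, Real.cos_two_mul, Real.cos_two_mul, Real.cos_sq_arctan]
  field_simp
  ring

lemma sin_four_arctan (r : ℝ) :
    Real.sin (4 * Real.arctan r) = 4 * r * (1 - r ^ 2) / (1 + r ^ 2) ^ 2 := by
  have h : 4 * Real.arctan r = 2 * (2 * Real.arctan r) := by ring
  have hr : 1 + r ^ 2 ≠ 0 := by positivity
  have hs : Real.sin (Real.arctan r) = r * Real.cos (Real.arctan r) := by
    rw [Real.sin_arctan, Real.cos_arctan]; ring
  rw [h, Real.sin_two_mul, Real.sin_two_mul, Real.cos_two_mul, Real.cos_sq_arctan, hs]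
  have : 2 * (2 * (r * Real.cos (Real.arctan r)) * Real.cos (Real.arctan r))
      = 4 * r * Real.cos (Real.arctan r) ^ 2 := by ring
  rw [this, Real.cos_sq_arctan]
  field_simp
  ring

/-- In the parametrisation `φ ↦ -ξ(k, φ)` of the circle of `k = k(λ, p)`, the point `p` itself
has the parameter `4 arctan |λ|`. -/
lemma xi_four_arctan (h : FrameAt p (θ p) (ω p)) (hz : z ≠ 0) :
    xi (kvec θ ω z p) (4 * Real.arctan ‖z‖) = -p := by
  have hr : ‖z‖ ≠ 0 := norm_ne_zero_iff.2 hz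
  have hr1 : 1 + ‖z‖ ^ 2 ≠ 0 := by positivity
  have hP := h.norm_pos.ne'
  rw [xi_kvec h hz, cos_four_arctan, sin_four_arctan]
  have e1 : (1 - 8 * ‖z‖ ^ 2 / (1 + ‖z‖ ^ 2) ^ 2 - 1) / 2
      + 4 * ‖z‖ * (1 - ‖z‖ ^ 2) / (1 + ‖z‖ ^ 2) ^ 2 * ((‖z‖ - 1 / ‖z‖) / 4) = -1 := by
    field_simp
    ring
  have e2 : (1 - 8 * ‖z‖ ^ 2 / (1 + ‖z‖ ^ 2) ^ 2 - 1) * (‖p‖ / 4 * (1 - 1 / ‖z‖ ^ 2))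
      - 4 * ‖z‖ * (1 - ‖z‖ ^ 2) / (1 + ‖z‖ ^ 2) ^ 2 * (‖p‖ / (2 * ‖z‖)) = 0 := by
    field_simp
    ring
  rw [e1, e2]
  simp

lemma norm_xi_kvec (h : FrameAt p (θ p) (ω p)) (hz : z ≠ 0) (φ : ℝ) :
    ‖xi (kvec θ ω z p) φ‖ = ‖p‖ * ((1 + ‖z‖ ^ 2) / (2 * ‖z‖)) * |Real.sin (φ / 2)| := by
  have hr : ‖z‖ ≠ 0 := norm_ne_zero_iff.2 hz
  have hv := onVariety_kvec h hz
  have hc : Real.cos φ = 1 - 2 * Real.sin (φ / 2) ^ 2 := by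
    have := Real.cos_two_mul' (φ / 2)
    rw [mul_div_cancel₀ φ two_ne_zero, Real.cos_sq'] at this
    rw [this]
    ring
  rw [← sq_eq_sq₀ (norm_nonneg _) (by positivity), ← real_inner_self_eq_norm_sq, hv.xi_xi,
    hv.re_re, real_inner_self_eq_norm_sq, norm_imVec_kvec h, hc, mul_pow _ |Real.sin _|, sq_abs]
  field_simp
  ring

lemma norm_add_xi_kvec (h : FrameAt p (θ p) (ω p)) (hz : z ≠ 0) (φ : ℝ) :
    ‖p + xi (kvec θ ω z p) φ‖
      = ‖p‖ * |Real.cos (φ / 2) + Real.sin (φ / 2) * ((‖z‖ ^ 2 - 1) / (2 * ‖z‖))| := by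
  have hr : ‖z‖ ≠ 0 := norm_ne_zero_iff.2 hz
  have pm : inner ℝ p (mdir θ ω z p) = (0 : ℝ) := by rw [real_inner_comm]; exact inner_mdir_p h
  have hc : Real.cos φ = 1 - 2 * Real.sin (φ / 2) ^ 2 := by
    have := Real.cos_two_mul' (φ / 2)
    rw [mul_div_cancel₀ φ two_ne_zero, Real.cos_sq'] at this
    rw [this]
    ring
  have hs : Real.sin φ = 2 * Real.sin (φ / 2) * Real.cos (φ / 2) := by
    have := Real.sin_two_mul (φ / 2)
    rwa [mul_div_cancel₀ φ two_ne_zero] at this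
  have hxx : inner ℝ (xi (kvec θ ω z p) φ) (xi (kvec θ ω z p) φ)
      = (‖p‖ * ((1 + ‖z‖ ^ 2) / (2 * ‖z‖)) * Real.sin (φ / 2)) ^ 2 := by
    rw [real_inner_self_eq_norm_sq, norm_xi_kvec h hz, mul_pow _ |Real.sin _|, sq_abs]
    ring
  have hpx : inner ℝ p (xi (kvec θ ω z p) φ)
      = ((Real.cos φ - 1) / 2 + Real.sin φ * ((‖z‖ - 1 / ‖z‖) / 4)) * ‖p‖ ^ 2 := by
    rw [xi_kvec h hz, inner_add_right, real_inner_smul_right, real_inner_smul_right, pm,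
      real_inner_self_eq_norm_sq]
    ring
  rw [← sq_eq_sq₀ (norm_nonneg _) (by positivity), ← real_inner_self_eq_norm_sq, inner_add_left,
    inner_add_right, inner_add_right, real_inner_comm p (xi _ _), hxx, hpx, mul_pow _ |_|, sq_abs,
    real_inner_self_eq_norm_sq, hc, hs]
  have := Real.sin_sq_add_cos_sq (φ / 2)
  have hcos : Real.cos (φ / 2) ^ 2 = 1 - Real.sin (φ / 2) ^ 2 := by linarith
  rw [add_sq (Real.cos _), hcos]
  field_simp
  ring

/-- The modulus of the weight in the definition of `{V₁, V₂}`; it is proportional to the product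
of the lengths of the two momenta `-ξ` and `p + ξ`. -/
lemma norm_coeff (h : FrameAt p (θ p) (ω p)) (hz : z ≠ 0) (φ : ℝ) :
    ‖(‖p‖ : ℂ) / 2 * (((‖z‖ : ℂ) ^ 2 - 1) / (starRingEnd ℂ z * (‖z‖ : ℂ)))
        * ((Real.cos φ - 1 : ℝ) : ℂ)
      - (‖p‖ : ℂ) / starRingEnd ℂ z * ((Real.sin φ : ℝ) : ℂ)‖
      = 4 * (‖xi (kvec θ ω z p) φ‖ * ‖p + xi (kvec θ ω z p) φ‖) / (‖p‖ * (1 + ‖z‖ ^ 2)) := by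
  have hr : 0 < ‖z‖ := norm_pos_iff.2 hz
  have hrc : (‖z‖ : ℂ) ≠ 0 := by exact_mod_cast hr.ne'
  have hP := h.norm_pos
  have hcz : starRingEnd ℂ z ≠ 0 := by simpa using hz
  have hc : Real.cos φ = 1 - 2 * Real.sin (φ / 2) ^ 2 := by
    have := Real.cos_two_mul' (φ / 2)
    rw [mul_div_cancel₀ φ two_ne_zero, Real.cos_sq'] at this
    rw [this]
    ring
  have hs : Real.sin φ = 2 * Real.sin (φ / 2) * Real.cos (φ / 2) := by
    have := Real.sin_two_mul (φ / 2)
    rwa [mul_div_cancel₀ φ two_ne_zero] at this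
  have e : (‖p‖ : ℂ) / 2 * (((‖z‖ : ℂ) ^ 2 - 1) / (starRingEnd ℂ z * (‖z‖ : ℂ)))
        * ((Real.cos φ - 1 : ℝ) : ℂ)
      - (‖p‖ : ℂ) / starRingEnd ℂ z * ((Real.sin φ : ℝ) : ℂ)
      = (1 / starRingEnd ℂ z) * ((-(2 * ‖p‖) * Real.sin (φ / 2) *
        (Real.cos (φ / 2) + Real.sin (φ / 2) * ((‖z‖ ^ 2 - 1) / (2 * ‖z‖))) : ℝ) : ℂ) := by
    rw [hc, hs]
    push_cast
    field_simp
    ring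
  rw [e, norm_mul, norm_div, norm_one, RCLike.norm_conj, Complex.norm_real, Real.norm_eq_abs,
    abs_mul, abs_mul, norm_xi_kvec h hz, norm_add_xi_kvec h hz, abs_neg, abs_of_pos (by positivity)]
  field_simp
  ring

end norms

/-! ### Differentiability of the coordinates -/

section differentiability

variable {X : Type*} [NormedAddCommGroup X] [NormedSpace ℝ X] {y : X}
  {θ ω : E3 → E3} {K : X → Fin 3 → ℂ} {Q : X → E3} {Z : X → ℂ} {f : X → ℝ}

lemma differentiableAt_ofReal (hf : DifferentiableAt ℝ f y) :
    DifferentiableAt ℝ (fun x => ((f x : ℝ) : ℂ)) y :=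
  Complex.ofRealCLM.differentiableAt.comp y hf

lemma differentiableAt_coord (hQ : DifferentiableAt ℝ Q y) (j : Fin 3) :
    DifferentiableAt ℝ (fun x => Q x j) y :=
  differentiableAt_euclidean.1 hQ j

lemma differentiableAt_cross {R : X → E3} (hQ : DifferentiableAt ℝ Q y)
    (hR : DifferentiableAt ℝ R y) : DifferentiableAt ℝ (fun x => cross (Q x) (R x)) y := by
  have hq := differentiableAt_coord hQ
  have hr := differentiableAt_coord hR
  rw [differentiableAt_euclidean]
  intro j
  fin_cases j
  · simp only [Fin.zero_eta, cross_zero_apply]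
    exact ((hq 1).mul (hr 2)).sub ((hq 2).mul (hr 1))
  · simp only [Fin.mk_one, cross_one_apply]
    exact ((hq 2).mul (hr 0)).sub ((hq 0).mul (hr 2))
  · simp only [Fin.reduceFinMk, cross_two_apply]
    exact ((hq 0).mul (hr 1)).sub ((hq 1).mul (hr 0))

lemma differentiableAt_reVec (hK : DifferentiableAt ℝ K y) :
    DifferentiableAt ℝ (fun x => reVec (K x)) y := by
  rw [differentiableAt_euclidean]
  intro j
  exact Complex.reCLM.differentiableAt.comp y (differentiableAt_pi.1 hK j)

lemma differentiableAt_imVec (hK : DifferentiableAt ℝ K y) :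
    DifferentiableAt ℝ (fun x => imVec (K x)) y := by
  rw [differentiableAt_euclidean]
  intro j
  exact Complex.imCLM.differentiableAt.comp y (differentiableAt_pi.1 hK j)

lemma differentiableAt_xi (hK : DifferentiableAt ℝ K y) (hf : DifferentiableAt ℝ f y)
    (h0 : imVec (K y) ≠ 0) : DifferentiableAt ℝ (fun x => xi (K x) (f x)) y := by
  have h1 := differentiableAt_reVec hK
  have h2 := differentiableAt_imVec hK
  have h3 : DifferentiableAt ℝ (fun x => kperp (K x)) y := by
    have h4 : DifferentiableAt ℝ (fun x => 1 / ‖imVec (K x)‖) y := by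
      simp only [one_div]
      exact (h2.norm ℝ h0).inv (norm_ne_zero_iff.2 h0)
    exact h4.smul (differentiableAt_cross h2 h1)
  exact ((hf.cos.sub_const 1).smul h1).add (hf.sin.smul h3)

lemma differentiableAt_shift (hK : DifferentiableAt ℝ K y) (hQ : DifferentiableAt ℝ Q y) :
    DifferentiableAt ℝ (fun x => shift (K x) (Q x)) y := by
  rw [differentiableAt_pi]
  intro j
  exact (differentiableAt_pi.1 hK j).add (differentiableAt_ofReal (differentiableAt_coord hQ j))

lemma differentiableAt_kvec (hZ : DifferentiableAt ℝ Z y) (hQ : DifferentiableAt ℝ Q y)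
    (hθ : DifferentiableAt ℝ θ (Q y)) (hω : DifferentiableAt ℝ ω (Q y)) (hz : Z y ≠ 0)
    (hq : Q y ≠ 0) : DifferentiableAt ℝ (fun x => kvec θ ω (Z x) (Q x)) y := by
  rw [differentiableAt_pi]
  intro j
  have h1 := differentiableAt_ofReal (differentiableAt_coord (hθ.comp y hQ) j)
  have h2 := differentiableAt_ofReal (differentiableAt_coord (hω.comp y hQ) j)
  have h3 := differentiableAt_ofReal (differentiableAt_coord hQ j)
  have h4 := differentiableAt_ofReal (hQ.norm ℝ hq)
  have h5 : DifferentiableAt ℝ (fun x => 1 / Z x) y := by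
    simp only [one_div]
    exact hZ.inv hz
  have h6 : DifferentiableAt ℝ (fun x => Complex.I * (‖Q x‖ : ℂ) / 4) y := by
    simp only [div_eq_mul_inv]
    exact (h4.const_mul _).mul_const _
  have h7 : DifferentiableAt ℝ (fun x => (‖Q x‖ : ℂ) / 4) y := by
    simp only [div_eq_mul_inv]
    exact h4.mul_const _
  have h8 : DifferentiableAt ℝ (fun x => ((Q x j : ℝ) : ℂ) / 2) y := by
    simp only [div_eq_mul_inv]
    exact h3.mul_const _
  exact (((h6.mul (hZ.add h5)).mul h1).add ((h7.mul (hZ.sub h5)).mul h2)).add h8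

lemma differentiableAt_lam (hK : DifferentiableAt ℝ K y) (hQ : DifferentiableAt ℝ Q y)
    (hθ : DifferentiableAt ℝ θ (Q y)) (hω : DifferentiableAt ℝ ω (Q y)) (hq : Q y ≠ 0) :
    DifferentiableAt ℝ (fun x => lam θ ω (K x) (Q x)) y := by
  have h1 := fun j => differentiableAt_ofReal (differentiableAt_coord (hθ.comp y hQ) j)
  have h2 := fun j => differentiableAt_ofReal (differentiableAt_coord (hω.comp y hQ) j)
  have h4 := differentiableAt_ofReal (hQ.norm ℝ hq)
  have h5 : DifferentiableAt ℝ (fun x => ∑ j, K x j * (((θ (Q x) j : ℝ) : ℂ)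
      + Complex.I * ((ω (Q x) j : ℝ) : ℂ))) y :=
    DifferentiableAt.fun_sum fun j _ =>
      (differentiableAt_pi.1 hK j).mul ((h1 j).add ((h2 j).const_mul _))
  have hne : Complex.I * (‖Q y‖ : ℂ) ≠ 0 :=
    mul_ne_zero Complex.I_ne_zero (by exact_mod_cast norm_ne_zero_iff.2 hq)
  simp only [lam, div_eq_mul_inv]
  exact (h5.const_mul 2).mul ((h4.const_mul _).inv hne)

end differentiability

/-! ### The axis and the domain -/

lemma axis_eq_span (ν : E3) : axis ν = (Submodule.span ℝ {ν} : Set E3) := by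
  ext p
  simp only [axis, Set.mem_ofPred_eq, SetLike.mem_coe, Submodule.mem_span_singleton]
  exact ⟨fun ⟨t, h⟩ => ⟨t, h.symm⟩, fun ⟨t, h⟩ => ⟨t, h.symm⟩⟩

lemma isClosed_axis (ν : E3) : IsClosed (axis ν) := by
  rw [axis_eq_span]
  exact Submodule.closed_of_finiteDimensional _

lemma volume_axis (ν : E3) : volume (axis ν) = 0 := by
  rw [axis_eq_span]
  refine Measure.addHaar_submodule _ _ fun h => ?_
  have h1 : Module.finrank ℝ (Submodule.span ℝ {ν}) ≤ 1 :=
    (finrank_span_le_card ({ν} : Set E3)).trans (by simp)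
  rw [h, finrank_top] at h1
  simp at h1

lemma ae_notMem_axis (ν : E3) : ∀ᵐ p : E3, p ∈ (axis ν)ᶜ :=
  measure_eq_zero_iff_ae_notMem.1 (volume_axis ν)

lemma restrict_axis_compl (ν : E3) :
    (volume : Measure E3).restrict (axis ν)ᶜ = volume :=
  Measure.restrict_eq_self_of_ae_mem (ae_notMem_axis ν)

lemma isOpen_dom (ν : E3) : IsOpen (dom ν) :=
  isOpen_compl_singleton.prod (isClosed_axis ν).isOpen_compl

lemma ae_mem_dom (ν : E3) : ∀ᵐ x : ℂ × E3, x ∈ dom ν := by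
  have h1 : ∀ᵐ z : ℂ, z ∈ ({0} : Set ℂ)ᶜ := compl_mem_ae_iff.2 (measure_singleton 0)
  have h2 : ∀ᵐ x : ℂ × E3, x.1 ∈ ({0} : Set ℂ)ᶜ :=
    Measure.quasiMeasurePreserving_fst.ae h1
  have h3 : ∀ᵐ x : ℂ × E3, x.2 ∈ (axis ν)ᶜ :=
    Measure.quasiMeasurePreserving_snd.ae (ae_notMem_axis ν)
  filter_upwards [h2, h3] with x hx1 hx2 using ⟨hx1, hx2⟩

lemma restrict_dom (ν : E3) : (volume : Measure (ℂ × E3)).restrict (dom ν) = volume :=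
  Measure.restrict_eq_self_of_ae_mem (ae_mem_dom ν)

namespace IsFrame

variable {ν : E3} {θ ω : E3 → E3} (h : IsFrame ν θ ω)
include h

lemma differentiableAt_θ {p : E3} (hp : p ∉ axis ν) : DifferentiableAt ℝ θ p :=
  (h.smooth_θ.differentiableOn (by simp)).differentiableAt
    ((isClosed_axis ν).isOpen_compl.mem_nhds hp)

lemma differentiableAt_ω {p : E3} (hp : p ∉ axis ν) : DifferentiableAt ℝ ω p :=
  (h.smooth_ω.differentiableOn (by simp)).differentiableAt
    ((isClosed_axis ν).isOpen_compl.mem_nhds hp)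

end IsFrame

/-! ### The substitutions in the integrand are nonsingular -/

/-- The vector `ξ(λ, p, φ)`. -/
noncomputable def xiAt (θ ω : E3 → E3) (y : (ℂ × E3) × ℝ) : E3 := xi (kvec θ ω y.1.1 y.1.2) y.2

/-- The coordinates of `(k, -ξ)`, where `k = k(λ, p)` and `ξ = ξ(λ, p, φ)`. -/
noncomputable def firstArg (θ ω : E3 → E3) (y : (ℂ × E3) × ℝ) : ℂ × E3 :=
  (lam θ ω (kvec θ ω y.1.1 y.1.2) (-xiAt θ ω y), -xiAt θ ω y)

/-- The coordinates of `(k + ξ, p + ξ)`, where `k = k(λ, p)` and `ξ = ξ(λ, p, φ)`. -/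
noncomputable def secondArg (θ ω : E3 → E3) (y : (ℂ × E3) × ℝ) : ℂ × E3 :=
  (lam θ ω (shift (kvec θ ω y.1.1 y.1.2) (xiAt θ ω y)) (y.1.2 + xiAt θ ω y), y.1.2 + xiAt θ ω y)

/-- The points where the first substitution is defined. -/
def firstDom (ν : E3) (θ ω : E3 → E3) : Set ((ℂ × E3) × ℝ) :=
  {y | y.1 ∈ dom ν ∧ -xiAt θ ω y ∈ (axis ν)ᶜ}

/-- The points where the second substitution is defined. -/
def secondDom (ν : E3) (θ ω : E3 → E3) : Set ((ℂ × E3) × ℝ) :=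
  {y | y.1 ∈ dom ν ∧ y.1.2 + xiAt θ ω y ∈ (axis ν)ᶜ}

instance isAddHaarMeasure_volume_prod : (volume : Measure (ℂ × E3)).IsAddHaarMeasure :=
  Measure.prod.instIsAddHaarMeasure (volume : Measure ℂ) (volume : Measure E3)

instance isAddHaarMeasure_volume_prod_prod :
    (volume : Measure ((ℂ × E3) × ℝ)).IsAddHaarMeasure :=
  Measure.prod.instIsAddHaarMeasure (volume : Measure (ℂ × E3)) (volume : Measure ℝ)

lemma volume_prod_univ {E : Set (ℂ × E3)} (hE : volume E = 0) :
    volume (E ×ˢ (Set.univ : Set ℝ)) = 0 := by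
  rw [Measure.volume_eq_prod, Measure.prod_prod, hE, zero_mul]

section substitutions

variable {ν : E3} {θ ω : E3 → E3} (h : IsFrame ν θ ω)
include h

lemma differentiableAt_kvec_fst {y : (ℂ × E3) × ℝ} (hy : y.1 ∈ dom ν) :
    DifferentiableAt ℝ (fun y : (ℂ × E3) × ℝ => kvec θ ω y.1.1 y.1.2) y :=
  differentiableAt_kvec (by fun_prop) (by fun_prop) (h.differentiableAt_θ hy.2)
    (h.differentiableAt_ω hy.2) hy.1 (ne_zero_of_notMem_axis hy.2)

lemma differentiableAt_xiAt {y : (ℂ × E3) × ℝ} (hy : y.1 ∈ dom ν) :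
    DifferentiableAt ℝ (xiAt θ ω) y :=
  differentiableAt_xi (differentiableAt_kvec_fst h hy) (by fun_prop)
    (onVariety_kvec (h.frameAt hy.2) hy.1).im_ne_zero

lemma differentiableAt_firstArg {y : (ℂ × E3) × ℝ} (hy : y ∈ firstDom ν θ ω) :
    DifferentiableAt ℝ (firstArg θ ω) y := by
  have h1 := (differentiableAt_xiAt h hy.1).neg
  exact (differentiableAt_lam (differentiableAt_kvec_fst h hy.1) h1
    (h.differentiableAt_θ hy.2) (h.differentiableAt_ω hy.2)
    (ne_zero_of_notMem_axis hy.2)).prodMk h1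

lemma differentiableAt_secondArg {y : (ℂ × E3) × ℝ} (hy : y ∈ secondDom ν θ ω) :
    DifferentiableAt ℝ (secondArg θ ω) y := by
  have h0 := differentiableAt_xiAt h hy.1
  have h1 : DifferentiableAt ℝ (fun y : (ℂ × E3) × ℝ => y.1.2 + xiAt θ ω y) y :=
    DifferentiableAt.add (by fun_prop) h0
  exact (differentiableAt_lam (differentiableAt_shift (differentiableAt_kvec_fst h hy.1) h0) h1
    (h.differentiableAt_θ hy.2) (h.differentiableAt_ω hy.2)
    (ne_zero_of_notMem_axis hy.2)).prodMk h1

/-- The first substitution pulls null sets back to null sets: together with the parameter of `p`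
on the circle it is invertible, with differentiable inverse, up to adding multiples of `2π`
to `φ`. -/
lemma volume_firstDom_inter_preimage {E : Set (ℂ × E3)} (hE : volume E = 0) :
    volume (firstDom ν θ ω ∩ firstArg θ ω ⁻¹' E) = 0 := by
  let Ψ : ℤ → (ℂ × E3) × ℝ → (ℂ × E3) × ℝ := fun n y =>
    (firstArg θ ω y, 4 * Real.arctan ‖y.1.1‖ + 2 * Real.pi * n)
  have hΨ : ∀ n, DifferentiableOn ℝ (Ψ n) (firstDom ν θ ω ∩ E ×ˢ Set.univ) := by
    intro n y hy
    have h1 : DifferentiableAt ℝ (fun y : (ℂ × E3) × ℝ => ‖y.1.1‖) y :=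
      DifferentiableAt.norm ℝ (by fun_prop) hy.1.1.1
    exact ((differentiableAt_firstArg h hy.1).prodMk
      ((h1.arctan.const_mul 4).add_const _)).differentiableWithinAt
  have hnull : ∀ n, volume (Ψ n '' (firstDom ν θ ω ∩ E ×ˢ Set.univ)) = 0 := fun n =>
    addHaar_image_eq_zero_of_differentiableOn_of_addHaar_eq_zero _ (hΨ n)
      (measure_mono_null Set.inter_subset_right (volume_prod_univ hE))
  refine measure_mono_null ?_ (measure_iUnion_null hnull)
  rintro ⟨⟨z, p⟩, φ⟩ ⟨⟨⟨hz, hp⟩, hx⟩, hyE⟩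
  have hz : z ≠ 0 := hz
  have hp : p ∉ axis ν := hp
  have hv := onVariety_kvec (h.frameAt hp) hz
  have hx' : -xi (kvec θ ω z p) φ ∉ axis ν := hx
  obtain ⟨hl, hk⟩ := (hv.neg_xi φ).lam_spec (h.frameAt hx')
  have hxi : xi (kvec θ ω z p) (4 * Real.arctan ‖z‖) = -p := xi_four_arctan (h.frameAt hp) hz
  have hxi2 := xi_four_arctan (h.frameAt hx') hl
  rw [hk, neg_neg] at hxi2
  obtain ⟨n, hn⟩ := hv.angle_eq hxi2.symm
  have hxa : xiAt θ ω (firstArg θ ω ((z, p), φ), 4 * Real.arctan ‖z‖) = -p := by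
    change xi (kvec θ ω (lam θ ω (kvec θ ω z p) (-xi (kvec θ ω z p) φ))
      (-xi (kvec θ ω z p) φ)) _ = _
    rw [hk, hxi]
  refine Set.mem_iUnion.2 ⟨n, (firstArg θ ω ((z, p), φ), 4 * Real.arctan ‖z‖),
    ⟨⟨⟨hl, hx⟩, ?_⟩, hyE, trivial⟩, ?_⟩
  · rw [hxa, neg_neg]
    exact hp
  · refine Prod.ext (Prod.ext ?_ ?_) ?_
    · change lam θ ω (kvec θ ω (lam θ ω (kvec θ ω z p) (-xi (kvec θ ω z p) φ))
        (-xi (kvec θ ω z p) φ)) (-xiAt θ ω _) = z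
      rw [hk, hxa, neg_neg, lam_kvec (h.frameAt hp)]
    · change -xiAt θ ω _ = p
      rw [hxa, neg_neg]
    · exact hn.symm

/-- The second substitution pulls null sets back to null sets: for fixed `φ` its inverse is the
substitution belonging to `-φ`. -/
lemma volume_secondDom_inter_preimage {E : Set (ℂ × E3)} (hE : volume E = 0) :
    volume (secondDom ν θ ω ∩ secondArg θ ω ⁻¹' E) = 0 := by
  let r : (ℂ × E3) × ℝ → (ℂ × E3) × ℝ := fun y => (y.1, -y.2)
  let Ψ : (ℂ × E3) × ℝ → (ℂ × E3) × ℝ := fun y => (secondArg θ ω (r y), -(r y).2)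
  have hΨ : DifferentiableOn ℝ Ψ (r ⁻¹' secondDom ν θ ω ∩ E ×ˢ Set.univ) := by
    intro y hy
    have hr : DifferentiableAt ℝ r y := by fun_prop
    have h1 : DifferentiableAt ℝ (fun y => secondArg θ ω (r y)) y :=
      (differentiableAt_secondArg h hy.1).comp y hr
    exact (h1.prodMk hr.snd.neg).differentiableWithinAt
  refine measure_mono_null ?_ (addHaar_image_eq_zero_of_differentiableOn_of_addHaar_eq_zero _ hΨ
      (measure_mono_null Set.inter_subset_right (volume_prod_univ hE)))
  rintro ⟨⟨z, p⟩, φ⟩ ⟨⟨⟨hz, hp⟩, hx⟩, hyE⟩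
  have hz : z ≠ 0 := hz
  have hp : p ∉ axis ν := hp
  have hv := onVariety_kvec (h.frameAt hp) hz
  have hx' : p + xi (kvec θ ω z p) φ ∉ axis ν := hx
  obtain ⟨hl, hk⟩ := (hv.shift φ).lam_spec (h.frameAt hx')
  have hxa : xiAt θ ω (secondArg θ ω ((z, p), φ), -φ) = -xi (kvec θ ω z p) φ := by
    change xi (kvec θ ω (lam θ ω (shift (kvec θ ω z p) (xi (kvec θ ω z p) φ))
      (p + xi (kvec θ ω z p) φ)) (p + xi (kvec θ ω z p) φ)) _ = _
    rw [hk, hv.xi_shift]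
  have hpp : p + xi (kvec θ ω z p) φ + xiAt θ ω (secondArg θ ω ((z, p), φ), -φ) = p := by
    rw [hxa]; abel
  refine ⟨(secondArg θ ω ((z, p), φ), φ), ⟨⟨⟨hl, hx⟩, ?_⟩, hyE, trivial⟩, ?_⟩
  · change p + xi (kvec θ ω z p) φ + xiAt θ ω (secondArg θ ω ((z, p), φ), -φ) ∉ axis ν
    rw [hpp]
    exact hp
  · refine Prod.ext (Prod.ext ?_ ?_) (neg_neg φ)
    · change lam θ ω (shift (kvec θ ω (lam θ ω (shift (kvec θ ω z p) (xi (kvec θ ω z p) φ))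
        (p + xi (kvec θ ω z p) φ)) (p + xi (kvec θ ω z p) φ))
        (xiAt θ ω (secondArg θ ω ((z, p), φ), -φ)))
        (p + xi (kvec θ ω z p) φ + xiAt θ ω (secondArg θ ω ((z, p), φ), -φ)) = z
      rw [hpp, hxa, hk, shift_shift_neg, lam_kvec (h.frameAt hp)]
    · exact hpp

end substitutions

/-! ### Almost every point is admissible for the substitutions -/

section conull

variable {ν : E3} {θ ω : E3 → E3} (h : IsFrame ν θ ω)
include h

lemma isOpen_firstDom : IsOpen (firstDom ν θ ω) := by
  have h1 : IsOpen {y : (ℂ × E3) × ℝ | y.1 ∈ dom ν} := (isOpen_dom ν).preimage continuous_fst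
  have h2 : ContinuousOn (fun y => -xiAt θ ω y) {y : (ℂ × E3) × ℝ | y.1 ∈ dom ν} := fun y hy =>
    (differentiableAt_xiAt h hy).neg.continuousAt.continuousWithinAt
  exact h2.isOpen_inter_preimage h1 (isClosed_axis ν).isOpen_compl

lemma isOpen_secondDom : IsOpen (secondDom ν θ ω) := by
  have h1 : IsOpen {y : (ℂ × E3) × ℝ | y.1 ∈ dom ν} := (isOpen_dom ν).preimage continuous_fst
  have h2 : ContinuousOn (fun y : (ℂ × E3) × ℝ => y.1.2 + xiAt θ ω y)
      {y : (ℂ × E3) × ℝ | y.1 ∈ dom ν} := fun y hy =>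
    (DifferentiableAt.add (by fun_prop)
      (differentiableAt_xiAt h hy)).continuousAt.continuousWithinAt
  exact h2.isOpen_inter_preimage h1 (isClosed_axis ν).isOpen_compl

/-- For almost every `(λ, p)` the plane orthogonal to `Im k(λ, p)` meets the axis only at `0`. -/
lemma ae_inner_imVec_ne_zero (hν : ν ≠ 0) : ∀ᵐ x : ℂ × E3,
    x ∈ dom ν ∧ inner ℝ (imVec (kvec θ ω x.1 x.2)) ν ≠ (0 : ℝ) := by
  have hcont : ContinuousOn (fun x : ℂ × E3 => (inner ℝ (imVec (kvec θ ω x.1 x.2)) ν : ℝ))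
      (dom ν) := by
    intro x hx
    have h1 : DifferentiableAt ℝ (fun x : ℂ × E3 => kvec θ ω x.1 x.2) x :=
      differentiableAt_kvec (by fun_prop) (by fun_prop) (h.differentiableAt_θ hx.2)
        (h.differentiableAt_ω hx.2) hx.1 (ne_zero_of_notMem_axis hx.2)
    exact ((differentiableAt_imVec h1).continuousAt.inner
      continuousAt_const).continuousWithinAt
  have hmeas : MeasurableSet {x : ℂ × E3 |
      x ∈ dom ν ∧ inner ℝ (imVec (kvec θ ω x.1 x.2)) ν ≠ (0 : ℝ)} :=
    (hcont.isOpen_inter_preimage (isOpen_dom ν) isOpen_compl_singleton).measurableSet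
  rw [Measure.volume_eq_prod, Measure.ae_prod_iff_ae_ae hmeas,
    Measure.ae_ae_comm (p := fun (z : ℂ) (p : E3) => (z, p) ∈ dom ν ∧
      inner ℝ (imVec (kvec θ ω z p)) ν ≠ (0 : ℝ)) hmeas]
  filter_upwards [ae_notMem_axis ν] with p hp
  have hf := h.frameAt hp
  -- for fixed `p`, the exceptional `λ` form a line
  let L : ℂ →ₗ[ℝ] ℝ := (inner ℝ (θ p) ν : ℝ) • Complex.reLm + (inner ℝ (ω p) ν : ℝ) • Complex.imLm
  have hL : LinearMap.ker L ≠ ⊤ := by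
    intro htop
    have h0 : L = 0 := LinearMap.ker_eq_top.1 htop
    have h1 : inner ℝ ν (θ p) = (0 : ℝ) := by
      have := congrArg (fun l : ℂ →ₗ[ℝ] ℝ => l 1) h0
      rw [real_inner_comm]
      simpa [L] using this
    have h2 : inner ℝ ν (ω p) = (0 : ℝ) := by
      have := congrArg (fun l : ℂ →ₗ[ℝ] ℝ => l Complex.I) h0
      rw [real_inner_comm]
      simpa [L] using this
    have h3 := hf.expand ν
    rw [h1, h2, zero_smul, zero_smul, add_zero, add_zero] at h3
    have h4 : (inner ℝ ν p / ‖p‖ ^ 2 : ℝ) ≠ 0 := by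
      intro h5
      rw [h5, zero_smul] at h3
      exact hν h3
    generalize (inner ℝ ν p / ‖p‖ ^ 2 : ℝ) = c at h3 h4
    exact hp ⟨c⁻¹, by rw [h3, smul_smul, inv_mul_cancel₀ h4, one_smul]⟩
  have hnull := Measure.addHaar_submodule (volume : Measure ℂ) _ hL
  have hz0 : ∀ᵐ z : ℂ, z ∈ ({0} : Set ℂ)ᶜ := compl_mem_ae_iff.2 (measure_singleton 0)
  filter_upwards [measure_eq_zero_iff_ae_notMem.1 hnull, hz0] with z hz hz0
  refine ⟨⟨hz0, hp⟩, ?_⟩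
  have hr : 0 < ‖z‖ := norm_pos_iff.2 hz0
  have hP := hf.norm_pos
  rw [imVec_kvec, real_inner_smul_left, inner_add_left, real_inner_smul_left,
    real_inner_smul_left]
  refine mul_ne_zero (by positivity) fun h0 => hz ?_
  rw [SetLike.mem_coe, LinearMap.mem_ker]
  simp only [L, LinearMap.add_apply, LinearMap.smul_apply, Complex.reLm_coe, Complex.imLm_coe,
    smul_eq_mul]
  linarith

lemma ae_mem_firstDom_secondDom (hν : ν ≠ 0) :
    ∀ᵐ y : (ℂ × E3) × ℝ, y ∈ firstDom ν θ ω ∩ secondDom ν θ ω := by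
  rw [Measure.volume_eq_prod, Measure.ae_prod_iff_ae_ae
    (p := fun y => y ∈ firstDom ν θ ω ∩ secondDom ν θ ω)
    ((isOpen_firstDom h).inter (isOpen_secondDom h)).measurableSet]
  filter_upwards [ae_inner_imVec_ne_zero h hν] with x hx
  obtain ⟨⟨hz, hp⟩, hin⟩ := hx
  have hf := h.frameAt hp
  have hv := onVariety_kvec hf hz
  -- the exceptional `φ` are those with `ξ = 0` or `p + ξ = 0`
  have hcount : ∀ ψ : ℝ, (Set.range fun n : ℤ => ψ + 2 * Real.pi * n).Countable :=
    fun ψ => Set.countable_range _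
  have hmem : ∀ v : E3, inner ℝ (imVec (kvec θ ω x.1 x.2)) v = (0 : ℝ) → v ∈ axis ν → v = 0 := by
    rintro v hv0 ⟨t, rfl⟩
    rw [real_inner_smul_right] at hv0
    rcases mul_eq_zero.1 hv0 with h0 | h0
    · rw [h0, zero_smul]
    · exact absurd h0 hin
  filter_upwards [(hcount 0).ae_notMem volume,
    (hcount (4 * Real.arctan ‖x.1‖)).ae_notMem volume] with φ h1 h2
  refine ⟨⟨⟨hz, hp⟩, fun hm => h1 ?_⟩, ⟨⟨hz, hp⟩, fun hm => h2 ?_⟩⟩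
  · have h3 := hmem _ (by rw [inner_neg_right]; exact neg_eq_zero.2 (hv.inner_im_xi φ)) hm
    have h4 : xi (kvec θ ω x.1 x.2) φ = xi (kvec θ ω x.1 x.2) 0 := by
      have h5 : xi (kvec θ ω x.1 x.2) 0 = 0 := by simp [xi]
      rw [h5]
      exact neg_eq_zero.1 h3
    obtain ⟨n, hn⟩ := hv.angle_eq h4
    exact ⟨n, hn.symm⟩
  · have h3 := hmem _ (by
      rw [inner_add_right, hv.im_p, zero_add]
      exact hv.inner_im_xi φ) hm
    have h4 : xi (kvec θ ω x.1 x.2) φ = xi (kvec θ ω x.1 x.2) (4 * Real.arctan ‖x.1‖) := by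
      rw [xi_four_arctan hf hz]
      exact eq_neg_of_add_eq_zero_right h3
    obtain ⟨n, hn⟩ := hv.angle_eq h4
    exact ⟨n, hn.symm⟩

lemma aemeasurable_firstArg (hν : ν ≠ 0) : AEMeasurable (firstArg θ ω) volume := by
  have h1 : ContinuousOn (firstArg θ ω) (firstDom ν θ ω) := fun y hy =>
    (differentiableAt_firstArg h hy).continuousAt.continuousWithinAt
  have h2 := h1.aemeasurable (μ := volume) (isOpen_firstDom h).measurableSet
  rwa [Measure.restrict_eq_self_of_ae_mem
    ((ae_mem_firstDom_secondDom h hν).mono fun _ hy => hy.1)] at h2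

lemma aemeasurable_secondArg (hν : ν ≠ 0) : AEMeasurable (secondArg θ ω) volume := by
  have h1 : ContinuousOn (secondArg θ ω) (secondDom ν θ ω) := fun y hy =>
    (differentiableAt_secondArg h hy).continuousAt.continuousWithinAt
  have h2 := h1.aemeasurable (μ := volume) (isOpen_secondDom h).measurableSet
  rwa [Measure.restrict_eq_self_of_ae_mem
    ((ae_mem_firstDom_secondDom h hν).mono fun _ hy => hy.2)] at h2

lemma map_firstArg_absolutelyContinuous (hν : ν ≠ 0) :
    Measure.map (firstArg θ ω) volume ≪ (volume : Measure (ℂ × E3)) := by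
  refine Measure.AbsolutelyContinuous.mk fun s hs h0 => ?_
  rw [Measure.map_apply_of_aemeasurable (aemeasurable_firstArg h hν) hs]
  rw [measure_eq_zero_iff_ae_notMem]
  filter_upwards [ae_mem_firstDom_secondDom h hν,
    measure_eq_zero_iff_ae_notMem.1 (volume_firstDom_inter_preimage h h0)] with y hy hy2 hy3
  exact hy2 ⟨hy.1, hy3⟩

lemma map_secondArg_absolutelyContinuous (hν : ν ≠ 0) :
    Measure.map (secondArg θ ω) volume ≪ (volume : Measure (ℂ × E3)) := by
  refine Measure.AbsolutelyContinuous.mk fun s hs h0 => ?_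
  rw [Measure.map_apply_of_aemeasurable (aemeasurable_secondArg h hν) hs]
  rw [measure_eq_zero_iff_ae_notMem]
  filter_upwards [ae_mem_firstDom_secondDom h hν,
    measure_eq_zero_iff_ae_notMem.1 (volume_secondDom_inter_preimage h h0)] with y hy hy2 hy3
  exact hy2 ⟨hy.2, hy3⟩

end conull

/-! ### Weakly singular integrals in the plane -/

/-- The weight `s / (1 + s² |ζ|²)` on the plane. -/
noncomputable def planeWeight (s : ℝ) (ζ : ℂ) : ℝ := s / (1 + (s * ‖ζ‖) ^ 2)

lemma planeWeight_nonneg {s : ℝ} (hs : 0 ≤ s) (ζ : ℂ) : 0 ≤ planeWeight s ζ := by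
  unfold planeWeight
  positivity

lemma sqrt_pow_three_inv {t : ℝ} (ht : 0 ≤ t) : (√t ^ 3)⁻¹ = t ^ (-(3 / 2) : ℝ) := by
  rw [Real.rpow_neg ht, Real.rpow_div_two_eq_sqrt _ ht]
  norm_cast

/-- The kernel `|u|⁻¹ + |u|^(-3/2)`. The second term controls the differences of `1 / u`. -/
noncomputable def singularKernel (u : ℂ) : ℝ := ‖u‖⁻¹ + (√‖u‖ ^ 3)⁻¹

lemma singularKernel_nonneg (u : ℂ) : 0 ≤ singularKernel u := by
  unfold singularKernel
  positivity

lemma measurable_singularKernel : Measurable singularKernel := by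
  unfold singularKernel
  fun_prop

/-- A translation invariant family of integrable majorants for the weakly singular integrals. -/
lemma exists_integrable_majorant : ∃ k j : ℂ → ℝ, Integrable k ∧ Integrable j ∧
    ∀ ζ u : ℂ, (1 + ‖ζ‖ ^ 2)⁻¹ * singularKernel u ≤ k u + j ζ := by
  have hfin : (Module.finrank ℝ ℂ : ℝ) < 3 := by
    rw [Complex.finrank_real_complex]; norm_num
  have hj : Integrable (fun ζ : ℂ => (√(1 + ‖ζ‖ ^ 2) ^ 3)⁻¹) := by
    have h := integrable_rpow_neg_one_add_norm_sq (E := ℂ) (μ := volume) hfin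
    refine h.congr (ae_of_all _ fun ζ => ?_)
    change _ = (√(1 + ‖ζ‖ ^ 2) ^ 3)⁻¹
    rw [sqrt_pow_three_inv (by positivity)]
    norm_num
  have hk : Integrable ((Metric.ball (0 : ℂ) 1).indicator fun u : ℂ => (√‖u‖ ^ 3)⁻¹) := by
    rw [integrable_indicator_iff Metric.isOpen_ball.measurableSet]
    refine integrableOn_ball_of_norm_le_rpow (C := 1) (α := 3 / 2) ?_ ?_ ?_ ?_
    · rw [Complex.finrank_real_complex]; norm_num
    · rw [Complex.finrank_real_complex]; norm_num
    · refine ae_of_all _ fun u => ?_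
      rw [Real.norm_of_nonneg (by positivity), one_mul, sqrt_pow_three_inv (norm_nonneg _)]
    · exact Measurable.aestronglyMeasurable (by fun_prop)
  refine ⟨fun u => 2 * (Metric.ball (0 : ℂ) 1).indicator (fun u : ℂ => (√‖u‖ ^ 3)⁻¹) u
    + 16 * (√(1 + ‖u‖ ^ 2) ^ 3)⁻¹, fun ζ => 2 * (√(1 + ‖ζ‖ ^ 2) ^ 3)⁻¹,
    (hk.const_mul 2).add (hj.const_mul 16), hj.const_mul 2, fun ζ u => ?_⟩
  have hnn1 : 0 ≤ (√(1 + ‖u‖ ^ 2) ^ 3)⁻¹ := by positivity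
  have hnn2 : 0 ≤ (√(1 + ‖ζ‖ ^ 2) ^ 3)⁻¹ := by positivity
  have ht : √‖u‖ ^ 2 = ‖u‖ := Real.sq_sqrt (norm_nonneg _)
  have ht0 : 0 ≤ √‖u‖ := Real.sqrt_nonneg _
  rcases lt_or_ge ‖u‖ 1 with hu | hu
  · have hmem : u ∈ Metric.ball (0 : ℂ) 1 := mem_ball_zero_iff.2 hu
    beta_reduce
    rw [Set.indicator_of_mem hmem]
    have h1 : (1 + ‖ζ‖ ^ 2)⁻¹ ≤ 1 := inv_le_one_of_one_le₀ (by nlinarith [sq_nonneg ‖ζ‖])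
    have h2 : ‖u‖⁻¹ ≤ (√‖u‖ ^ 3)⁻¹ := by
      rcases ht0.eq_or_lt with h0 | h0
      · rw [← ht, ← h0]; simp
      · refine inv_anti₀ (by positivity) ?_
        have h3 : √‖u‖ ≤ 1 := Real.sqrt_le_one.2 hu.le
        calc √‖u‖ ^ 3 = ‖u‖ * √‖u‖ := by rw [pow_succ, ht]
          _ ≤ ‖u‖ := mul_le_of_le_one_right (norm_nonneg _) h3
    have h4 : (1 + ‖ζ‖ ^ 2)⁻¹ * singularKernel u ≤ singularKernel u :=
      mul_le_of_le_one_left (singularKernel_nonneg u) h1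
    have h5 : singularKernel u ≤ 2 * (√‖u‖ ^ 3)⁻¹ := by unfold singularKernel; linarith
    linarith
  · have hmem : u ∉ Metric.ball (0 : ℂ) 1 := fun h => hu.not_gt (mem_ball_zero_iff.1 h)
    beta_reduce
    rw [Set.indicator_of_notMem hmem]
    have h3 : 1 ≤ √‖u‖ := Real.one_le_sqrt.2 hu
    have h2 : (√‖u‖ ^ 3)⁻¹ ≤ ‖u‖⁻¹ := by
      refine inv_anti₀ (by linarith) ?_
      calc ‖u‖ ≤ ‖u‖ * √‖u‖ := le_mul_of_one_le_right (norm_nonneg _) h3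
        _ = √‖u‖ ^ 3 := by rw [pow_succ, ht]
    have h5 : singularKernel u ≤ 2 * ‖u‖⁻¹ := by unfold singularKernel; linarith
    set c : ℝ := (√(1 + ‖ζ‖ ^ 2))⁻¹ with hc
    set b : ℝ := ‖u‖⁻¹ with hb
    have hc0 : 0 ≤ c := by positivity
    have hb0 : 0 ≤ b := by positivity
    have e1 : (1 + ‖ζ‖ ^ 2)⁻¹ = c ^ 2 := by
      rw [hc, inv_pow, Real.sq_sqrt (by positivity)]
    have e2 : (√(1 + ‖ζ‖ ^ 2) ^ 3)⁻¹ = c ^ 3 := by rw [hc, inv_pow]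
    have e3 : b ^ 3 ≤ 8 * (√(1 + ‖u‖ ^ 2) ^ 3)⁻¹ := by
      have h6 : √(1 + ‖u‖ ^ 2) ≤ 2 * ‖u‖ := by
        rw [Real.sqrt_le_left (by positivity)]
        nlinarith
      have h7 : √(1 + ‖u‖ ^ 2) ^ 3 ≤ (2 * ‖u‖) ^ 3 := by gcongr
      have h8 : ((2 * ‖u‖) ^ 3)⁻¹ ≤ (√(1 + ‖u‖ ^ 2) ^ 3)⁻¹ := inv_anti₀ (by positivity) h7
      calc b ^ 3 = 8 * ((2 * ‖u‖) ^ 3)⁻¹ := by rw [hb, mul_pow, mul_inv, inv_pow]; ring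
        _ ≤ _ := by linarith
    have e4 : c ^ 2 * b ≤ c ^ 3 + b ^ 3 := by
      rcases le_total b c with hbc | hbc
      · calc c ^ 2 * b ≤ c ^ 2 * c := by gcongr
          _ ≤ _ := by nlinarith [pow_nonneg hb0 3]
      · calc c ^ 2 * b ≤ b ^ 2 * b := by gcongr
          _ ≤ _ := by nlinarith [pow_nonneg hc0 3]
    rw [e1, e2]
    have h9 : c ^ 2 * singularKernel u ≤ c ^ 2 * (2 * b) := by gcongr
    nlinarith

lemma exists_singular_integral_bound : ∃ C : ℝ, 0 < C ∧ ∀ z : ℂ,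
    Integrable (fun ζ : ℂ => (1 + ‖ζ‖ ^ 2)⁻¹ * singularKernel (ζ - z)) ∧
    ∫ ζ : ℂ, (1 + ‖ζ‖ ^ 2)⁻¹ * singularKernel (ζ - z) ≤ C := by
  obtain ⟨k, j, hk, hj, hkj⟩ := exists_integrable_majorant
  refine ⟨max (∫ u, k u + j u) 1, by positivity, fun z => ?_⟩
  have h1 : Integrable (fun ζ : ℂ => k (ζ - z) + j ζ) := (hk.comp_sub_right z).add hj
  have hle : ∀ ζ : ℂ, (1 + ‖ζ‖ ^ 2)⁻¹ * singularKernel (ζ - z) ≤ k (ζ - z) + j ζ :=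
    fun ζ => hkj ζ (ζ - z)
  have h2 : Integrable (fun ζ : ℂ => (1 + ‖ζ‖ ^ 2)⁻¹ * singularKernel (ζ - z)) := by
    refine h1.mono' ?_ (ae_of_all _ fun ζ => ?_)
    · have := measurable_singularKernel
      exact Measurable.aestronglyMeasurable (by fun_prop)
    · rw [Real.norm_of_nonneg (mul_nonneg (by positivity) (singularKernel_nonneg _))]
      exact hle ζ
  refine ⟨h2, (integral_mono h2 h1 hle).trans ?_⟩
  rw [integral_add (hk.comp_sub_right z) hj, integral_sub_right_eq_self k z, ← integral_add hk hj]
  exact le_max_left _ _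

/-- By scaling, the weakly singular integral of `planeWeight s` is bounded uniformly in `s`. -/
lemma exists_planeWeight_integral_bound : ∃ C : ℝ, 0 < C ∧ ∀ s : ℝ, 0 < s → ∀ z : ℂ,
    Integrable (fun ζ : ℂ => planeWeight s ζ * ‖ζ - z‖⁻¹) ∧
    ∫ ζ : ℂ, planeWeight s ζ * ‖ζ - z‖⁻¹ ≤ C := by
  obtain ⟨C, hC, h⟩ := exists_singular_integral_bound
  refine ⟨C, hC, fun s hs z => ?_⟩
  let f : ℂ → ℝ := fun ζ => (1 + ‖ζ‖ ^ 2)⁻¹ * ‖ζ - s • z‖⁻¹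
  have hle : ∀ ζ, f ζ ≤ (1 + ‖ζ‖ ^ 2)⁻¹ * singularKernel (ζ - s • z) := fun ζ => by
    refine mul_le_mul_of_nonneg_left ?_ (by positivity)
    unfold singularKernel
    have : 0 ≤ (√‖ζ - s • z‖ ^ 3)⁻¹ := by positivity
    linarith
  have hf : Integrable f := by
    refine (h (s • z)).1.mono' (Measurable.aestronglyMeasurable (by fun_prop))
      (ae_of_all _ fun ζ => ?_)
    rw [Real.norm_of_nonneg (by positivity)]
    exact hle ζ
  have hfi : ∫ ζ, f ζ ≤ C := (integral_mono hf (h (s • z)).1 hle).trans (h (s • z)).2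
  have e : (fun ζ : ℂ => planeWeight s ζ * ‖ζ - z‖⁻¹) = fun ζ => s ^ 2 * f (s • ζ) := by
    funext ζ
    simp only [f, planeWeight]
    rw [← smul_sub, norm_smul, norm_smul, Real.norm_of_nonneg hs.le, mul_inv]
    field_simp
  have hfs : Integrable (fun ζ => f (s • ζ)) := (integrable_comp_smul_iff _ f hs.ne').2 hf
  refine ⟨by rw [e]; exact hfs.const_mul _, ?_⟩
  rw [e, integral_const_mul, Measure.integral_comp_smul, Complex.finrank_real_complex,
    smul_eq_mul, abs_of_pos (by positivity), ← mul_assoc, mul_inv_cancel₀ (by positivity),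
    one_mul]
  exact hfi

/-! ### Cauchy transforms -/

lemma norm_one_div_sub_le {u v : ℂ} (hu : u ≠ 0) (hv : v ≠ 0) :
    ‖1 / u - 1 / v‖ ≤ 2 * √‖u - v‖ * ((√‖u‖ ^ 3)⁻¹ + (√‖v‖ ^ 3)⁻¹) := by
  wlog huv : ‖u‖ ≤ ‖v‖ generalizing u v
  · have := this hv hu (le_of_not_ge huv)
    rw [norm_sub_rev, norm_sub_rev u v, add_comm]
    exact this
  have hu0 : 0 < ‖u‖ := norm_pos_iff.2 hu
  have hv0 : 0 < ‖v‖ := norm_pos_iff.2 hv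
  have e : 1 / u - 1 / v = (v - u) / (u * v) := by field_simp
  rw [e, norm_div, norm_mul, norm_sub_rev v u]
  have hd : ‖u - v‖ ≤ 2 * ‖v‖ := by
    have := norm_sub_le u v
    linarith
  set a := √‖u‖
  set b := √‖v‖
  set d := √‖u - v‖
  have ea : ‖u‖ = a ^ 2 := (Real.sq_sqrt (norm_nonneg _)).symm
  have eb : ‖v‖ = b ^ 2 := (Real.sq_sqrt (norm_nonneg _)).symm
  have ed : ‖u - v‖ = d ^ 2 := (Real.sq_sqrt (norm_nonneg _)).symm
  have ha : 0 < a := Real.sqrt_pos.2 hu0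
  have hb : 0 < b := Real.sqrt_pos.2 hv0
  have hd0 : 0 ≤ d := Real.sqrt_nonneg _
  have hab : a ≤ b := Real.sqrt_le_sqrt huv
  rw [ed, eb] at hd
  have hdb : d ≤ 2 * b := by nlinarith
  rw [ea, eb, ed]
  have h1 : d ^ 2 / (a ^ 2 * b ^ 2) ≤ 2 * d * (a ^ 3)⁻¹ := by
    rw [← div_eq_mul_inv, div_le_div_iff₀ (by positivity) (by positivity)]
    have h2 : d * a ≤ 2 * b ^ 2 := by nlinarith
    calc d ^ 2 * a ^ 3 = d * a ^ 2 * (d * a) := by ring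
      _ ≤ d * a ^ 2 * (2 * b ^ 2) := by gcongr
      _ = 2 * d * (a ^ 2 * b ^ 2) := by ring
  have h3 : 0 ≤ 2 * d * (b ^ 3)⁻¹ := by positivity
  linarith

lemma planeWeight_le {s : ℝ} (hs : 0 < s) (ζ : ℂ) :
    planeWeight s ζ ≤ (s + s⁻¹) * (1 + ‖ζ‖ ^ 2)⁻¹ := by
  unfold planeWeight
  rw [← div_eq_mul_inv, div_le_div_iff₀ (by positivity) (by positivity)]
  have h1 : 0 ≤ s ^ 3 * ‖ζ‖ ^ 2 := by positivity
  have h2 : 0 < s⁻¹ := by positivity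
  have h3 : s⁻¹ * (s * ‖ζ‖) ^ 2 = s * ‖ζ‖ ^ 2 := by field_simp
  nlinarith

/-- A function with `|g| ≤ K / (1 + |ζ|²)` has a continuous Cauchy transform. -/
lemma continuous_cauchyTransform {g : ℂ → ℂ} {K : ℝ}
    (hK : ∀ᵐ ζ, ‖g ζ‖ ≤ K * (1 + ‖ζ‖ ^ 2)⁻¹)
    (hint : ∀ z, Integrable fun ζ => g ζ / (ζ - z)) :
    Continuous fun z => ∫ ζ, g ζ / (ζ - z) := by
  obtain ⟨C, hC, h⟩ := exists_singular_integral_bound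
  have hbound : ∀ z w : ℂ, ‖(∫ ζ, g ζ / (ζ - z)) - ∫ ζ, g ζ / (ζ - w)‖
      ≤ 2 * |K| * √‖w - z‖ * (C + C) := by
    intro z w
    rw [← integral_sub (hint z) (hint w)]
    have hI : Integrable (fun ζ : ℂ => 2 * |K| * √‖w - z‖ *
        ((1 + ‖ζ‖ ^ 2)⁻¹ * singularKernel (ζ - z)
          + (1 + ‖ζ‖ ^ 2)⁻¹ * singularKernel (ζ - w))) :=
      ((h z).1.add (h w).1).const_mul _
    refine (norm_integral_le_of_norm_le hI ?_).trans ?_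
    · have hz : ∀ᵐ ζ : ℂ, ζ ∈ ({z} : Set ℂ)ᶜ := compl_mem_ae_iff.2 (measure_singleton z)
      have hw : ∀ᵐ ζ : ℂ, ζ ∈ ({w} : Set ℂ)ᶜ := compl_mem_ae_iff.2 (measure_singleton w)
      filter_upwards [hK, hz, hw] with ζ h1 h2 h3
      have e : g ζ / (ζ - z) - g ζ / (ζ - w) = g ζ * (1 / (ζ - z) - 1 / (ζ - w)) := by ring
      have h4 := norm_one_div_sub_le (sub_ne_zero.2 h2) (sub_ne_zero.2 h3)
      have e2 : ζ - z - (ζ - w) = w - z := by ring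
      rw [e2] at h4
      have h5 : (√‖ζ - z‖ ^ 3)⁻¹ ≤ singularKernel (ζ - z) := by
        unfold singularKernel
        have : 0 ≤ ‖ζ - z‖⁻¹ := by positivity
        linarith
      have h6 : (√‖ζ - w‖ ^ 3)⁻¹ ≤ singularKernel (ζ - w) := by
        unfold singularKernel
        have : 0 ≤ ‖ζ - w‖⁻¹ := by positivity
        linarith
      have h7 : ‖g ζ‖ ≤ |K| * (1 + ‖ζ‖ ^ 2)⁻¹ :=
        h1.trans (mul_le_mul_of_nonneg_right (le_abs_self K) (by positivity))
      rw [e, norm_mul]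
      calc ‖g ζ‖ * ‖1 / (ζ - z) - 1 / (ζ - w)‖
          ≤ (|K| * (1 + ‖ζ‖ ^ 2)⁻¹) * (2 * √‖w - z‖ *
              (singularKernel (ζ - z) + singularKernel (ζ - w))) := by
            refine mul_le_mul h7 (h4.trans ?_) (norm_nonneg _) (by positivity)
            exact mul_le_mul_of_nonneg_left (add_le_add h5 h6) (by positivity)
        _ = _ := by ring
    · rw [integral_const_mul, integral_add (h z).1 (h w).1]
      exact mul_le_mul_of_nonneg_left (add_le_add (h z).2 (h w).2) (by positivity)
  rw [continuous_iff_continuousAt]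
  intro w
  rw [ContinuousAt, tendsto_iff_norm_sub_tendsto_zero]
  have hlim : Tendsto (fun z : ℂ => 2 * |K| * √‖w - z‖ * (C + C)) (𝓝 w) (𝓝 0) := by
    have : Continuous fun z : ℂ => 2 * |K| * √‖w - z‖ * (C + C) := by fun_prop
    have h0 := this.tendsto w
    simpa using h0
  exact squeeze_zero (fun _ => norm_nonneg _) (fun z => hbound z w) hlim

lemma continuous_cauchyTransform_of_le_planeWeight {g : ℂ → ℂ} {K s : ℝ} (hK0 : 0 ≤ K) (hs : 0 < s)
    (hK : ∀ᵐ ζ, ‖g ζ‖ ≤ K * (planeWeight s ζ + planeWeight s⁻¹ ζ))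
    (hint : ∀ z, Integrable fun ζ => g ζ / (ζ - z)) :
    Continuous fun z => ∫ ζ, g ζ / (ζ - z) := by
  refine continuous_cauchyTransform (K := K * (2 * (s + s⁻¹))) ?_ hint
  filter_upwards [hK] with ζ h
  have h1 := planeWeight_le hs ζ
  have h2 := planeWeight_le (inv_pos.2 hs) ζ
  rw [inv_inv] at h2
  refine h.trans ?_
  rw [mul_assoc]
  exact mul_le_mul_of_nonneg_left (by linarith) hK0

/-- Existence and boundedness of Cauchy transforms, with a constant independent of the scale. -/
lemma exists_cauchyTransform_bound : ∃ C : ℝ, 0 < C ∧ ∀ (g : ℂ → ℂ) (K s : ℝ), 0 ≤ K → 0 < s →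
    AEStronglyMeasurable g volume →
    (∀ᵐ ζ, ‖g ζ‖ ≤ K * (planeWeight s ζ + planeWeight s⁻¹ ζ)) →
    ∀ z, Integrable (fun ζ => g ζ / (ζ - z)) ∧ ‖∫ ζ, g ζ / (ζ - z)‖ ≤ C * K := by
  obtain ⟨C, hC, h⟩ := exists_planeWeight_integral_bound
  refine ⟨2 * C, by positivity, fun g K s hK0 hs hg hK z => ?_⟩
  have h1 := h s hs z
  have h2 := h s⁻¹ (inv_pos.2 hs) z
  have hI : Integrable (fun ζ : ℂ => K * (planeWeight s ζ * ‖ζ - z‖⁻¹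
      + planeWeight s⁻¹ ζ * ‖ζ - z‖⁻¹)) := (h1.1.add h2.1).const_mul K
  have hle : ∀ᵐ ζ, ‖g ζ / (ζ - z)‖ ≤ K * (planeWeight s ζ * ‖ζ - z‖⁻¹
      + planeWeight s⁻¹ ζ * ‖ζ - z‖⁻¹) := by
    filter_upwards [hK] with ζ hζ
    rw [norm_div, div_eq_mul_inv, ← add_mul, ← mul_assoc]
    exact mul_le_mul_of_nonneg_right hζ (by positivity)
  have hm : AEStronglyMeasurable (fun ζ => g ζ / (ζ - z)) volume := by
    simp only [div_eq_mul_inv]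
    exact hg.mul (Measurable.aestronglyMeasurable (by fun_prop))
  refine ⟨hI.mono' hm hle, (norm_integral_le_of_norm_le hI hle).trans ?_⟩
  rw [integral_const_mul, integral_add h1.1 h2.1]
  calc K * _ ≤ K * (C + C) := mul_le_mul_of_nonneg_left (add_le_add h1.2 h2.2) hK0
    _ = 2 * C * K := by ring

/-! ### The pointwise bound for the integrand -/

lemma mul_one_add_rpow_neg_le_one {μ x : ℝ} (hμ : 1 ≤ μ) (hx : 0 ≤ x) :
    x * (1 + x) ^ (-μ) ≤ 1 := by
  have h1 : (1 + x) ^ (-μ) ≤ (1 + x) ^ (-1 : ℝ) :=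
    Real.rpow_le_rpow_of_exponent_le (by linarith) (by linarith)
  rw [Real.rpow_neg_one] at h1
  calc x * (1 + x) ^ (-μ) ≤ x * (1 + x)⁻¹ := mul_le_mul_of_nonneg_left h1 hx
    _ ≤ 1 := by rw [← div_eq_mul_inv, div_le_one (by positivity)]; linarith

lemma two_rpow_mul_one_add_rpow_neg {μ P : ℝ} (hP : 0 ≤ P) :
    (2 : ℝ) ^ μ * (1 + P) ^ (-μ) = ((1 + P) / 2) ^ (-μ) := by
  rw [Real.div_rpow (by positivity) (by norm_num), Real.rpow_neg (by norm_num : (0 : ℝ) ≤ 2),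
    div_inv_eq_mul, mul_comm]

lemma product_bound_of_large {μ P x y : ℝ} (hμ : 1 ≤ μ) (hP : 1 ≤ P) (hx : 0 ≤ x) (hxy : x ≤ y)
    (hsum : P ≤ x + y) :
    x * y * ((1 + x) ^ (-μ) * (1 + y) ^ (-μ)) ≤ P * (2 ^ μ * (1 + P) ^ (-μ)) := by
  have hy : 0 ≤ y := hx.trans hxy
  have h1 := mul_one_add_rpow_neg_le_one hμ hx
  have h2 : y * (1 + y) ^ (-μ) ≤ P * (2 ^ μ * (1 + P) ^ (-μ)) := by
    have h3 : y * (1 + y) ^ (-μ) ≤ (1 + y) ^ (1 - μ) := by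
      rw [sub_eq_add_neg, Real.rpow_add (by positivity), Real.rpow_one]
      exact mul_le_mul_of_nonneg_right (by linarith) (by positivity)
    have h4 : (1 + y) ^ (1 - μ) ≤ ((1 + P) / 2) ^ (1 - μ) :=
      Real.rpow_le_rpow_of_nonpos (by positivity) (by linarith) (by linarith)
    have h5 : ((1 + P) / 2) ^ (1 - μ) = (1 + P) / 2 * (2 ^ μ * (1 + P) ^ (-μ)) := by
      rw [two_rpow_mul_one_add_rpow_neg (by linarith), sub_eq_add_neg,
        Real.rpow_add (by positivity), Real.rpow_one]
    rw [h5] at h4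
    refine (h3.trans h4).trans ?_
    exact mul_le_mul_of_nonneg_right (by linarith) (by positivity)
  calc x * y * ((1 + x) ^ (-μ) * (1 + y) ^ (-μ))
      = (x * (1 + x) ^ (-μ)) * (y * (1 + y) ^ (-μ)) := by ring
    _ ≤ 1 * (P * (2 ^ μ * (1 + P) ^ (-μ))) := mul_le_mul h1 h2 (by positivity) zero_le_one
    _ = _ := one_mul _

/-- If `x, y` are the lengths of two momenta with sum of length `P`, subject to the bounds coming
from the radius of the circle, the weight `4xy / (P (1 + |ζ|²))` and the decay of the two
factors combine to the decay of order `μ` in `P` times planar weights of reciprocal scales. -/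
lemma integrand_bound {μ P x y : ℝ} {ζ : ℂ} (hμ : 1 ≤ μ) (hP : 0 < P) (hζ : ζ ≠ 0) (hx : 0 ≤ x)
    (hy : 0 ≤ y) (hxr : x ≤ P * ((1 + ‖ζ‖ ^ 2) / (2 * ‖ζ‖)))
    (hyr : y ≤ P * ((1 + ‖ζ‖ ^ 2) / (2 * ‖ζ‖))) (hsum : P ≤ x + y) :
    4 * (x * y) / (P * (1 + ‖ζ‖ ^ 2)) * ((1 + x) ^ (-μ) * (1 + y) ^ (-μ))
      ≤ 8 * 2 ^ μ * (1 + P) ^ (-μ)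
        * (planeWeight (min P 1) ζ + planeWeight (min P 1)⁻¹ ζ) := by
  have hr : 0 < ‖ζ‖ := norm_pos_iff.2 hζ
  set r := ‖ζ‖ with hrdef
  have hA : 0 < (2 : ℝ) ^ μ * (1 + P) ^ (-μ) := by positivity
  rcases le_total 1 P with h1 | h1
  · have key : x * y * ((1 + x) ^ (-μ) * (1 + y) ^ (-μ)) ≤ P * (2 ^ μ * (1 + P) ^ (-μ)) := by
      rcases le_total x y with hxy | hxy
      · exact product_bound_of_large hμ h1 hx hxy hsum
      · have := product_bound_of_large hμ h1 hy hxy (by linarith)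
        calc x * y * ((1 + x) ^ (-μ) * (1 + y) ^ (-μ))
            = y * x * ((1 + y) ^ (-μ) * (1 + x) ^ (-μ)) := by ring
          _ ≤ _ := this
    rw [min_eq_right h1, inv_one]
    unfold planeWeight
    rw [← hrdef, one_mul]
    calc 4 * (x * y) / (P * (1 + r ^ 2)) * ((1 + x) ^ (-μ) * (1 + y) ^ (-μ))
        = 4 / (P * (1 + r ^ 2)) * (x * y * ((1 + x) ^ (-μ) * (1 + y) ^ (-μ))) := by ring
      _ ≤ 4 / (P * (1 + r ^ 2)) * (P * (2 ^ μ * (1 + P) ^ (-μ))) := by gcongr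
      _ = 4 * (2 ^ μ * (1 + P) ^ (-μ)) * (1 / (1 + r ^ 2)) := by field_simp
      _ ≤ 16 * (2 ^ μ * (1 + P) ^ (-μ)) * (1 / (1 + r ^ 2)) := by
        gcongr
        norm_num
      _ = _ := by ring
  · rw [min_eq_left h1]
    have hA1 : 1 ≤ (2 : ℝ) ^ μ * (1 + P) ^ (-μ) := by
      rw [two_rpow_mul_one_add_rpow_neg hP.le]
      exact Real.one_le_rpow_of_pos_of_le_one_of_nonpos (by positivity) (by linarith)
        (by linarith)
    set m := x * y * ((1 + x) ^ (-μ) * (1 + y) ^ (-μ)) with hm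
    have hm0 : 0 ≤ m := by positivity
    have hm1 : m ≤ 1 := by
      have e : m = (x * (1 + x) ^ (-μ)) * (y * (1 + y) ^ (-μ)) := by rw [hm]; ring
      rw [e]
      exact mul_le_one₀ (mul_one_add_rpow_neg_le_one hμ hx) (by positivity)
        (mul_one_add_rpow_neg_le_one hμ hy)
    have hm2 : m ≤ x * y := by
      have h2 : (1 + x) ^ (-μ) ≤ 1 :=
        Real.rpow_le_one_of_one_le_of_nonpos (by linarith) (by linarith)
      have h3 : (1 + y) ^ (-μ) ≤ 1 :=
        Real.rpow_le_one_of_one_le_of_nonpos (by linarith) (by linarith)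
      exact mul_le_of_le_one_right (by positivity) (mul_le_one₀ h2 (by positivity) h3)
    have hmin : ∀ B : ℝ, 0 ≤ B → x ≤ B → y ≤ B → m * (1 + B ^ 2) ≤ 2 * B ^ 2 := by
      intro B hB hxB hyB
      have h2 : m ≤ B ^ 2 := hm2.trans (by rw [sq]; exact mul_le_mul hxB hyB hy hB)
      nlinarith [sq_nonneg B]
    have hw1 := planeWeight_nonneg hP.le ζ
    have hw2 := planeWeight_nonneg (inv_pos.2 hP).le ζ
    have hmain : 4 * m / (P * (1 + r ^ 2)) ≤ 8 * (planeWeight P ζ + planeWeight P⁻¹ ζ) := by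
      rcases le_total 1 r with h2 | h2
      · have hB : P * ((1 + r ^ 2) / (2 * r)) ≤ P * r := by
          gcongr
          rw [div_le_iff₀ (by positivity)]
          nlinarith
        have h3 := hmin (P * r) (by positivity) (hxr.trans hB) (hyr.trans hB)
        have h4 : 4 * m / (P * (1 + r ^ 2)) ≤ 8 * planeWeight P ζ := by
          unfold planeWeight
          rw [← hrdef, ← mul_div_assoc, div_le_div_iff₀ (by positivity) (by positivity)]
          nlinarith [mul_pos hP hP]
        linarith
      · have hB : P * ((1 + r ^ 2) / (2 * r)) ≤ P / r := by
          rw [div_eq_mul_inv P r]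
          gcongr
          rw [← one_div, div_le_div_iff₀ (by positivity) (by positivity)]
          nlinarith
        have h3 := hmin (P / r) (by positivity) (hxr.trans hB) (hyr.trans hB)
        have h5 : m * (r ^ 2 + P ^ 2) ≤ 2 * P ^ 2 := by
          have h6 := mul_le_mul_of_nonneg_right h3 (sq_nonneg r)
          have e1 : m * (1 + (P / r) ^ 2) * r ^ 2 = m * (r ^ 2 + P ^ 2) := by field_simp
          have e2 : 2 * (P / r) ^ 2 * r ^ 2 = 2 * P ^ 2 := by field_simp
          linarith
        have h4 : 4 * m / (P * (1 + r ^ 2)) ≤ 8 * planeWeight P⁻¹ ζ := by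
          have e : planeWeight P⁻¹ ζ = P / (r ^ 2 + P ^ 2) := by
            unfold planeWeight
            rw [← hrdef]
            field_simp
            ring
          rw [e, ← mul_div_assoc, div_le_div_iff₀ (by positivity) (by positivity)]
          nlinarith [mul_pos hP hP, sq_nonneg r, mul_nonneg (mul_pos hP hP).le (sq_nonneg r)]
        linarith
    calc 4 * (x * y) / (P * (1 + r ^ 2)) * ((1 + x) ^ (-μ) * (1 + y) ^ (-μ))
        = 4 * m / (P * (1 + r ^ 2)) := by rw [hm]; ring
      _ ≤ 8 * (planeWeight P ζ + planeWeight P⁻¹ ζ) := hmain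
      _ ≤ (2 ^ μ * (1 + P) ^ (-μ)) * (8 * (planeWeight P ζ + planeWeight P⁻¹ ζ)) :=
        le_mul_of_one_le_left (by positivity) hA1
      _ = _ := by ring

/-! ### The weighted space of bounded functions -/

/-- The pointwise form of `|||U|||_μ ≤ N`. -/
def WBound (μ N : ℝ) (U : ℂ × E3 → ℂ) : Prop :=
  ∀ᵐ x : ℂ × E3, ‖U x‖ ≤ N * (1 + ‖x.2‖) ^ (-μ)

lemma one_add_norm_rpow_pos (μ : ℝ) (p : E3) : 0 < (1 + ‖p‖) ^ μ := by positivity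

lemma norm_weight_mul (μ : ℝ) (U : ℂ × E3 → ℂ) (x : ℂ × E3) :
    ‖(((1 + ‖x.2‖) ^ μ : ℝ) : ℂ) * U x‖ = (1 + ‖x.2‖) ^ μ * ‖U x‖ := by
  rw [norm_mul, Complex.norm_real, Real.norm_of_nonneg (one_add_norm_rpow_pos μ x.2).le]

lemma norm_le_iff_weight (μ N : ℝ) (U : ℂ × E3 → ℂ) (x : ℂ × E3) :
    ‖U x‖ ≤ N * (1 + ‖x.2‖) ^ (-μ) ↔ ‖(((1 + ‖x.2‖) ^ μ : ℝ) : ℂ) * U x‖ ≤ N := by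
  rw [norm_weight_mul, Real.rpow_neg (by positivity), ← div_eq_mul_inv,
    le_div_iff₀ (one_add_norm_rpow_pos μ x.2), mul_comm]

section weighted

variable {ν : E3} {μ N : ℝ} {U V : ℂ × E3 → ℂ}

lemma MemW.aestronglyMeasurable (h : MemW ν μ U) : AEStronglyMeasurable U volume := by
  have := h.1.aestronglyMeasurable
  rwa [restrict_dom] at this

lemma wNorm_nonneg (ν : E3) (μ : ℝ) (U : ℂ × E3 → ℂ) : 0 ≤ wNorm ν μ U :=
  ENNReal.toReal_nonneg

lemma MemW.wBound (h : MemW ν μ U) : WBound μ (wNorm ν μ U) U := by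
  have h1 := ae_le_eLpNormEssSup (f := fun x : ℂ × E3 => (((1 + ‖x.2‖) ^ μ : ℝ) : ℂ) * U x)
    (μ := volume)
  have h2 := h.2
  filter_upwards [h1] with x hx
  rw [norm_le_iff_weight]
  have h3 : eWNorm ν μ U = eLpNormEssSup (fun x : ℂ × E3 =>
      (((1 + ‖x.2‖) ^ μ : ℝ) : ℂ) * U x) volume := by
    rw [eWNorm, restrict_dom, eLpNorm_exponent_top]
  rw [← h3] at hx
  have h4 := ENNReal.toReal_mono h2.ne hx
  rwa [toReal_enorm] at h4

lemma eWNorm_le_of_wBound (h : WBound μ N U) : eWNorm ν μ U ≤ ENNReal.ofReal N := by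
  rw [eWNorm, restrict_dom, eLpNorm_exponent_top]
  refine eLpNormEssSup_le_of_ae_bound ?_
  filter_upwards [h] with x hx
  rwa [← norm_le_iff_weight]

lemma wNorm_le_of_wBound (hN : 0 ≤ N) (h : WBound μ N U) : wNorm ν μ U ≤ N :=
  ENNReal.toReal_le_of_le_ofReal hN (eWNorm_le_of_wBound h)

lemma memW_of_wBound (hμ : 0 ≤ μ) (hm : AEStronglyMeasurable U volume) (h : WBound μ N U) :
    MemW ν μ U := by
  refine ⟨?_, (eWNorm_le_of_wBound h).trans_lt ENNReal.ofReal_lt_top⟩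
  rw [restrict_dom]
  refine memLp_top_of_bound hm |N| ?_
  filter_upwards [h] with x hx
  have h1 : (1 + ‖x.2‖) ^ (-μ) ≤ 1 :=
    Real.rpow_le_one_of_one_le_of_nonpos (by linarith [norm_nonneg x.2]) (by linarith)
  have h2 : 0 ≤ (1 + ‖x.2‖) ^ (-μ) := (one_add_norm_rpow_pos _ _).le
  calc ‖U x‖ ≤ N * (1 + ‖x.2‖) ^ (-μ) := hx
    _ ≤ |N| * (1 + ‖x.2‖) ^ (-μ) := mul_le_mul_of_nonneg_right (le_abs_self N) h2
    _ ≤ |N| := mul_le_of_le_one_right (abs_nonneg N) h1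

lemma WBound.add {M : ℝ} (hU : WBound μ N U) (hV : WBound μ M V) : WBound μ (N + M) (U + V) := by
  filter_upwards [hU, hV] with x h1 h2
  rw [Pi.add_apply, add_mul]
  exact (norm_add_le _ _).trans (add_le_add h1 h2)

lemma WBound.neg (hU : WBound μ N U) : WBound μ N (-U) := by
  filter_upwards [hU] with x h1
  rwa [Pi.neg_apply, norm_neg]

lemma WBound.sub {M : ℝ} (hU : WBound μ N U) (hV : WBound μ M V) : WBound μ (N + M) (U - V) := by
  rw [sub_eq_add_neg]
  exact hU.add hV.neg

lemma WBound.mono {M : ℝ} (hU : WBound μ N U) (hNM : N ≤ M) : WBound μ M U := by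
  filter_upwards [hU] with x h1
  exact h1.trans (mul_le_mul_of_nonneg_right hNM (one_add_norm_rpow_pos _ _).le)

lemma wBound_zero (μ : ℝ) : WBound μ 0 0 := ae_of_all _ fun x => by simp

lemma eqDom_iff : EqDom ν U V ↔ U =ᵐ[volume] V := by
  rw [EqDom, restrict_dom]

lemma MemW.add (hμ : 0 ≤ μ) (hU : MemW ν μ U) (hV : MemW ν μ V) : MemW ν μ (U + V) :=
  memW_of_wBound hμ (hU.aestronglyMeasurable.add hV.aestronglyMeasurable)
    (hU.wBound.add hV.wBound)

lemma MemW.sub (hμ : 0 ≤ μ) (hU : MemW ν μ U) (hV : MemW ν μ V) : MemW ν μ (U - V) :=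
  memW_of_wBound hμ (hU.aestronglyMeasurable.sub hV.aestronglyMeasurable)
    (hU.wBound.sub hV.wBound)

lemma memW_zero (hμ : 0 ≤ μ) : MemW ν μ 0 :=
  memW_of_wBound hμ aestronglyMeasurable_const (wBound_zero μ)

lemma wNorm_zero : wNorm ν μ 0 = 0 :=
  le_antisymm (wNorm_le_of_wBound le_rfl (wBound_zero μ)) (wNorm_nonneg _ _ _)

lemma wNorm_add_le (hU : MemW ν μ U) (hV : MemW ν μ V) :
    wNorm ν μ (U + V) ≤ wNorm ν μ U + wNorm ν μ V :=
  wNorm_le_of_wBound (add_nonneg (wNorm_nonneg _ _ _) (wNorm_nonneg _ _ _))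
    (hU.wBound.add hV.wBound)

lemma wNorm_congr (hUV : U =ᵐ[volume] V) : wNorm ν μ U = wNorm ν μ V := by
  unfold wNorm eWNorm
  rw [restrict_dom]
  congr 1
  refine eLpNorm_congr_ae ?_
  filter_upwards [hUV] with x hx
  rw [hx]

lemma WBound.ae_eq (h : WBound μ 0 (U - V)) : U =ᵐ[volume] V := by
  filter_upwards [h] with x hx
  rw [zero_mul, norm_le_zero_iff] at hx
  exact sub_eq_zero.1 hx

end weighted

/-! ### Slices -/

lemma ae_of_ae_slices {Q : ℂ × E3 → Prop}
    (h : ∀ᵐ p : E3, ∀ z : ℂ, z ≠ 0 → Q (z, p)) : ∀ᵐ x : ℂ × E3, Q x := by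
  have h0 : ∀ᵐ z : ℂ, z ∈ ({0} : Set ℂ)ᶜ := compl_mem_ae_iff.2 (measure_singleton 0)
  filter_upwards [(Measure.quasiMeasurePreserving_snd (μ := (volume : Measure ℂ))).ae h,
    (Measure.quasiMeasurePreserving_fst (ν := (volume : Measure E3))).ae h0] with x hx hx0
  exact hx x.1 hx0

lemma ae_slices_of_ae {Q : ℂ × E3 → Prop} (h : ∀ᵐ x : ℂ × E3, Q x) :
    ∀ᵐ p : E3, ∀ᵐ z : ℂ, Q (z, p) := by
  have h1 : ∀ᵐ y ∂((volume : Measure E3).prod (volume : Measure ℂ)), Q y.swap :=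
    (Measure.measurePreserving_swap (μ := (volume : Measure E3))
      (ν := (volume : Measure ℂ))).quasiMeasurePreserving.ae h
  exact Measure.ae_ae_of_ae_prod h1

lemma ae_slices_aestronglyMeasurable {g : ℂ × E3 → ℂ} (hg : AEStronglyMeasurable g volume) :
    ∀ᵐ p : E3, AEStronglyMeasurable (fun z => g (z, p)) volume :=
  hg.prod_swap.prodMk_left

/-! ### The quadratic expression under the Cauchy transform -/

section pair

variable {ν : E3} {θ ω : E3 → E3} {U₁ U₂ V₁ V₂ : ℂ × E3 → ℂ} {μ N₁ N₂ : ℝ}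

/-- The scalar weight of the integrand of `{V₁, V₂}`. -/
noncomputable def coeff (y : (ℂ × E3) × ℝ) : ℂ :=
  (‖y.1.2‖ : ℂ) / 2 * (((‖y.1.1‖ : ℂ) ^ 2 - 1) / (starRingEnd ℂ y.1.1 * (‖y.1.1‖ : ℂ)))
        * ((Real.cos y.2 - 1 : ℝ) : ℂ)
      - (‖y.1.2‖ : ℂ) / starRingEnd ℂ y.1.1 * ((Real.sin y.2 : ℝ) : ℂ)

lemma measurable_coeff : Measurable coeff := by
  have h1 : Measurable fun y : (ℂ × E3) × ℝ => starRingEnd ℂ y.1.1 :=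
    Complex.continuous_conj.measurable.comp (by fun_prop)
  have h2 : Measurable fun y : (ℂ × E3) × ℝ => (‖y.1.1‖ : ℂ) :=
    Complex.measurable_ofReal.comp (by fun_prop)
  have h3 : Measurable fun y : (ℂ × E3) × ℝ => (‖y.1.2‖ : ℂ) :=
    Complex.measurable_ofReal.comp (by fun_prop)
  have h4 : Measurable fun y : (ℂ × E3) × ℝ => ((Real.cos y.2 - 1 : ℝ) : ℂ) :=
    Complex.measurable_ofReal.comp (by fun_prop)
  have h5 : Measurable fun y : (ℂ × E3) × ℝ => ((Real.sin y.2 : ℝ) : ℂ) :=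
    Complex.measurable_ofReal.comp (by fun_prop)
  exact (((h3.div_const 2).mul (((h2.pow_const 2).sub_const 1).div (h1.mul h2))).mul h4).sub
    ((h3.div h1).mul h5)

lemma braceIntegrand_lift (U₁ U₂ : ℂ × E3 → ℂ) (y : (ℂ × E3) × ℝ) :
    braceIntegrand θ ω (lift θ ω U₁) (lift θ ω U₂) y.1 y.2
      = coeff y * U₁ (firstArg θ ω y) * U₂ (secondArg θ ω y) := rfl

lemma aestronglyMeasurable_braceIntegrand (h : IsFrame ν θ ω) (hν : ν ≠ 0)
    (h₁ : AEStronglyMeasurable U₁ volume) (h₂ : AEStronglyMeasurable U₂ volume) :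
    AEStronglyMeasurable (fun y : (ℂ × E3) × ℝ =>
      braceIntegrand θ ω (lift θ ω U₁) (lift θ ω U₂) y.1 y.2) volume := by
  simp only [braceIntegrand_lift]
  exact (measurable_coeff.aestronglyMeasurable.mul
    ((h₁.mono_ac (map_firstArg_absolutelyContinuous h hν)).comp_aemeasurable
      (aemeasurable_firstArg h hν))).mul
    ((h₂.mono_ac (map_secondArg_absolutelyContinuous h hν)).comp_aemeasurable
      (aemeasurable_secondArg h hν))

lemma ae_firstArg (h : IsFrame ν θ ω) (hν : ν ≠ 0) {Q : ℂ × E3 → Prop}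
    (hQ : ∀ᵐ x : ℂ × E3, Q x) : ∀ᵐ y : (ℂ × E3) × ℝ, Q (firstArg θ ω y) :=
  ae_of_ae_map (aemeasurable_firstArg h hν)
    ((map_firstArg_absolutelyContinuous h hν).ae_le hQ)

lemma ae_secondArg (h : IsFrame ν θ ω) (hν : ν ≠ 0) {Q : ℂ × E3 → Prop}
    (hQ : ∀ᵐ x : ℂ × E3, Q x) : ∀ᵐ y : (ℂ × E3) × ℝ, Q (secondArg θ ω y) :=
  ae_of_ae_map (aemeasurable_secondArg h hν)
    ((map_secondArg_absolutelyContinuous h hν).ae_le hQ)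

/-- The majorant of the integrand of `(U₁, U₂)`, up to the norms of `U₁` and `U₂`. -/
noncomputable def majorant (μ : ℝ) (x : ℂ × E3) : ℝ :=
  8 * 2 ^ μ * (1 + ‖x.2‖) ^ (-μ)
    * (planeWeight (min ‖x.2‖ 1) x.1 + planeWeight (min ‖x.2‖ 1)⁻¹ x.1)

lemma norm_braceIntegrand_le (h : IsFrame ν θ ω) (hν : ν ≠ 0) (hμ : 1 ≤ μ) (hN₁ : 0 ≤ N₁)
    (h₁ : WBound μ N₁ U₁) (h₂ : WBound μ N₂ U₂) :
    ∀ᵐ y : (ℂ × E3) × ℝ, ‖braceIntegrand θ ω (lift θ ω U₁) (lift θ ω U₂) y.1 y.2‖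
      ≤ N₁ * N₂ * majorant μ y.1 := by
  filter_upwards [ae_firstArg h hν h₁, ae_secondArg h hν h₂,
    ae_mem_firstDom_secondDom h hν] with y hy1 hy2 hy
  obtain ⟨hz, hp⟩ := hy.1.1
  have hf := h.frameAt hp
  have hN₂ : 0 ≤ N₂ := by
    by_contra! hneg
    have h3 := (norm_nonneg _).trans hy2
    have h4 := one_add_norm_rpow_pos (-μ) (secondArg θ ω y).2
    nlinarith
  rw [braceIntegrand_lift, norm_mul, norm_mul]
  have hc : ‖coeff y‖ = _ := norm_coeff hf hz y.2
  rw [hc]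
  set x := ‖xi (kvec θ ω y.1.1 y.1.2) y.2‖ with hx
  set w := ‖y.1.2 + xi (kvec θ ω y.1.1 y.1.2) y.2‖ with hw
  have e1 : ‖(firstArg θ ω y).2‖ = x := by
    change ‖-xi (kvec θ ω y.1.1 y.1.2) y.2‖ = x
    rw [norm_neg]
  have e2 : ‖(secondArg θ ω y).2‖ = w := rfl
  rw [e1] at hy1
  rw [e2] at hy2
  have hr : 0 < ‖y.1.1‖ := norm_pos_iff.2 hz
  have hsin := Real.abs_sin_le_one (y.2 / 2)
  have hxr : x ≤ ‖y.1.2‖ * ((1 + ‖y.1.1‖ ^ 2) / (2 * ‖y.1.1‖)) := by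
    rw [hx, norm_xi_kvec hf hz]
    exact mul_le_of_le_one_right (by positivity) hsin
  have hwr : w ≤ ‖y.1.2‖ * ((1 + ‖y.1.1‖ ^ 2) / (2 * ‖y.1.1‖)) := by
    rw [hw, norm_add_xi_kvec hf hz]
    refine mul_le_mul_of_nonneg_left (abs_le_of_sq_le_sq ?_ (by positivity)) (norm_nonneg _)
    have hcs := Real.sin_sq_add_cos_sq (y.2 / 2)
    set d := (‖y.1.1‖ ^ 2 - 1) / (2 * ‖y.1.1‖) with hd
    have hd2 : ((1 + ‖y.1.1‖ ^ 2) / (2 * ‖y.1.1‖)) ^ 2 = 1 + d ^ 2 := by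
      rw [hd]
      field_simp
      ring
    rw [hd2]
    -- Cauchy's inequality in the plane
    nlinarith [sq_nonneg (Real.sin (y.2 / 2) - Real.cos (y.2 / 2) * d)]
  have hsum : ‖y.1.2‖ ≤ x + w := by
    have h3 := norm_sub_le (y.1.2 + xi (kvec θ ω y.1.1 y.1.2) y.2)
      (xi (kvec θ ω y.1.1 y.1.2) y.2)
    rw [add_sub_cancel_right] at h3
    linarith
  have key := integrand_bound hμ hf.norm_pos hz (norm_nonneg _) (norm_nonneg _) hxr hwr hsum
  have hA : 0 ≤ 4 * (x * w) / (‖y.1.2‖ * (1 + ‖y.1.1‖ ^ 2)) := by positivity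
  calc 4 * (x * w) / (‖y.1.2‖ * (1 + ‖y.1.1‖ ^ 2)) * ‖U₁ (firstArg θ ω y)‖
        * ‖U₂ (secondArg θ ω y)‖
      ≤ 4 * (x * w) / (‖y.1.2‖ * (1 + ‖y.1.1‖ ^ 2)) * (N₁ * (1 + x) ^ (-μ))
        * (N₂ * (1 + w) ^ (-μ)) := by
        refine mul_le_mul (mul_le_mul_of_nonneg_left hy1 hA) hy2 (norm_nonneg _) ?_
        positivity
    _ = N₁ * N₂ * (4 * (x * w) / (‖y.1.2‖ * (1 + ‖y.1.1‖ ^ 2))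
        * ((1 + x) ^ (-μ) * (1 + w) ^ (-μ))) := by ring
    _ ≤ _ := mul_le_mul_of_nonneg_left key (mul_nonneg hN₁ hN₂)

lemma ae_intervalIntegrable_braceIntegrand (h : IsFrame ν θ ω) (hν : ν ≠ 0) (hμ : 1 ≤ μ)
    (h₁ : MemW ν μ U₁) (h₂ : MemW ν μ U₂) : ∀ᵐ x : ℂ × E3,
      IntervalIntegrable (braceIntegrand θ ω (lift θ ω U₁) (lift θ ω U₂) x)
        volume (-Real.pi) Real.pi := by
  have hm := aestronglyMeasurable_braceIntegrand h hν h₁.aestronglyMeasurable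
    h₂.aestronglyMeasurable
  have hb := norm_braceIntegrand_le h hν hμ (wNorm_nonneg _ _ _) h₁.wBound h₂.wBound
  filter_upwards [Measure.ae_ae_of_ae_prod hb, hm.prodMk_left] with x hx hmx
  refine (intervalIntegrable_const (c := wNorm ν μ U₁ * wNorm ν μ U₂ * majorant μ x)).mono_fun
    hmx.restrict ?_
  filter_upwards [ae_restrict_of_ae hx] with φ hφ
  exact hφ.trans (le_abs_self _)

lemma aestronglyMeasurable_pair (h : IsFrame ν θ ω) (hν : ν ≠ 0)
    (h₁ : AEStronglyMeasurable U₁ volume) (h₂ : AEStronglyMeasurable U₂ volume) :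
    AEStronglyMeasurable (pair θ ω U₁ U₂) volume := by
  have hm := aestronglyMeasurable_braceIntegrand h hν h₁ h₂
  have hac : (volume : Measure (ℂ × E3)).prod
      ((volume : Measure ℝ).restrict (Set.Ioc (-Real.pi) Real.pi)) ≪ volume :=
    Measure.AbsolutelyContinuous.rfl.prod Measure.absolutelyContinuous_restrict
  have h3 := (hm.mono_ac hac).integral_prod_right'
  have e : pair θ ω U₁ U₂ = fun x => -((Real.pi : ℂ) / 4) *
      ∫ φ in Set.Ioc (-Real.pi) Real.pi,
        braceIntegrand θ ω (lift θ ω U₁) (lift θ ω U₂) x φ := by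
    funext x
    rw [pair, brace, intervalIntegral.integral_of_le (by linarith [Real.pi_pos])]
  rw [e]
  exact h3.const_mul _

lemma norm_pair_le (h : IsFrame ν θ ω) (hν : ν ≠ 0) (hμ : 1 ≤ μ)
    (h₁ : MemW ν μ U₁) (h₂ : MemW ν μ U₂) : ∀ᵐ x : ℂ × E3, ‖pair θ ω U₁ U₂ x‖
      ≤ Real.pi ^ 2 / 2 * (wNorm ν μ U₁ * wNorm ν μ U₂ * majorant μ x) := by
  have hb := norm_braceIntegrand_le h hν hμ (wNorm_nonneg _ _ _) h₁.wBound h₂.wBound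
  filter_upwards [Measure.ae_ae_of_ae_prod hb] with x hx
  have h3 := intervalIntegral.norm_integral_le_of_norm_le_const_ae (a := -Real.pi) (b := Real.pi)
    (C := wNorm ν μ U₁ * wNorm ν μ U₂ * majorant μ x)
    (f := braceIntegrand θ ω (lift θ ω U₁) (lift θ ω U₂) x)
    (hx.mono fun φ hφ _ => hφ)
  have hpi := Real.pi_pos
  rw [pair, brace, norm_mul, norm_neg, norm_div, Complex.norm_real, Real.norm_of_nonneg hpi.le]
  have e : |Real.pi - -Real.pi| = 2 * Real.pi := by
    rw [abs_of_pos (by linarith)]; ring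
  rw [e] at h3
  have h4 : ‖(4 : ℂ)‖ = 4 := by simp
  rw [h4]
  calc Real.pi / 4 * _ ≤ Real.pi / 4 * (wNorm ν μ U₁ * wNorm ν μ U₂ * majorant μ x
        * (2 * Real.pi)) := mul_le_mul_of_nonneg_left h3 (by positivity)
    _ = _ := by ring

lemma pair_congr (h : IsFrame ν θ ω) (hν : ν ≠ 0) (h₁ : U₁ =ᵐ[volume] V₁)
    (h₂ : U₂ =ᵐ[volume] V₂) : pair θ ω U₁ U₂ =ᵐ[volume] pair θ ω V₁ V₂ := by
  have h3 : ∀ᵐ y : (ℂ × E3) × ℝ, braceIntegrand θ ω (lift θ ω U₁) (lift θ ω U₂) y.1 y.2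
      = braceIntegrand θ ω (lift θ ω V₁) (lift θ ω V₂) y.1 y.2 := by
    filter_upwards [ae_firstArg h hν h₁, ae_secondArg h hν h₂] with y hy1 hy2
    rw [braceIntegrand_lift, braceIntegrand_lift, hy1, hy2]
  filter_upwards [Measure.ae_ae_of_ae_prod h3] with x hx
  rw [pair, pair, brace, brace]
  congr 1
  exact intervalIntegral.integral_congr_ae (hx.mono fun φ hφ _ => hφ)

lemma pair_smul_add_left (h : IsFrame ν θ ω) (hν : ν ≠ 0) (hμ : 1 ≤ μ) (a : ℂ)
    (h₁ : MemW ν μ U₁) (h₂ : MemW ν μ U₂) (hV : MemW ν μ V₁) :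
    pair θ ω (a • U₁ + V₁) U₂ =ᵐ[volume] a • pair θ ω U₁ U₂ + pair θ ω V₁ U₂ := by
  filter_upwards [ae_intervalIntegrable_braceIntegrand h hν hμ h₁ h₂,
    ae_intervalIntegrable_braceIntegrand h hν hμ hV h₂] with x hx1 hx2
  have e : braceIntegrand θ ω (lift θ ω (a • U₁ + V₁)) (lift θ ω U₂) x
      = fun φ => a * braceIntegrand θ ω (lift θ ω U₁) (lift θ ω U₂) x φ
        + braceIntegrand θ ω (lift θ ω V₁) (lift θ ω U₂) x φ := by
    funext φ
    simp only [braceIntegrand, lift, Pi.add_apply, Pi.smul_apply, smul_eq_mul]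
    ring
  rw [Pi.add_apply, Pi.smul_apply, smul_eq_mul]
  unfold pair brace
  rw [e, intervalIntegral.integral_add (hx1.const_mul a) hx2,
    intervalIntegral.integral_const_mul]
  ring

lemma pair_smul_add_right (h : IsFrame ν θ ω) (hν : ν ≠ 0) (hμ : 1 ≤ μ) (a : ℂ)
    (h₁ : MemW ν μ U₁) (h₂ : MemW ν μ U₂) (hV : MemW ν μ V₂) :
    pair θ ω U₁ (a • U₂ + V₂) =ᵐ[volume] a • pair θ ω U₁ U₂ + pair θ ω U₁ V₂ := by
  filter_upwards [ae_intervalIntegrable_braceIntegrand h hν hμ h₁ h₂,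
    ae_intervalIntegrable_braceIntegrand h hν hμ h₁ hV] with x hx1 hx2
  have e : braceIntegrand θ ω (lift θ ω U₁) (lift θ ω (a • U₂ + V₂)) x
      = fun φ => a * braceIntegrand θ ω (lift θ ω U₁) (lift θ ω U₂) x φ
        + braceIntegrand θ ω (lift θ ω U₁) (lift θ ω V₂) x φ := by
    funext φ
    simp only [braceIntegrand, lift, Pi.add_apply, Pi.smul_apply, smul_eq_mul]
    ring
  rw [Pi.add_apply, Pi.smul_apply, smul_eq_mul]
  unfold pair brace
  rw [e, intervalIntegral.integral_add (hx1.const_mul a) hx2,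
    intervalIntegral.integral_const_mul]
  ring

end pair

/-! ### The Cauchy transform of the quadratic expression -/

section operators

variable {ν : E3} {θ ω : E3 → E3} {lam₀ : E3 → ℂ} {U U₁ U₂ V₁ V₂ W₁ W₂ : ℂ × E3 → ℂ} {μ : ℝ}

lemma aestronglyMeasurable_cauchyTransform {g c : ℂ × E3 → ℂ} (hg : AEStronglyMeasurable g volume)
    (hc : AEMeasurable c volume) :
    AEStronglyMeasurable (fun x : ℂ × E3 => ∫ ζ : ℂ, g (ζ, x.2) / (ζ - c x)) volume := by
  have hq : Measure.QuasiMeasurePreserving (fun y : (ℂ × E3) × ℂ => (y.2, y.1.2))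
      ((volume : Measure (ℂ × E3)).prod (volume : Measure ℂ)) volume :=
    (Measure.measurePreserving_swap (μ := (volume : Measure E3))
      (ν := (volume : Measure ℂ))).quasiMeasurePreserving.comp
      (QuasiMeasurePreserving.prodMap
        (Measure.quasiMeasurePreserving_snd (μ := (volume : Measure ℂ))
          (ν := (volume : Measure E3)))
        (Measure.QuasiMeasurePreserving.id (volume : Measure ℂ)))
  have h1 : AEStronglyMeasurable (fun y : (ℂ × E3) × ℂ => g (y.2, y.1.2))
      ((volume : Measure (ℂ × E3)).prod (volume : Measure ℂ)) :=
    hg.comp_quasiMeasurePreserving hq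
  have h2 : AEMeasurable (fun y : (ℂ × E3) × ℂ => (y.2 - c y.1)⁻¹)
      ((volume : Measure (ℂ × E3)).prod (volume : Measure ℂ)) :=
    (measurable_snd.aemeasurable.sub
      (hc.comp_quasiMeasurePreserving Measure.quasiMeasurePreserving_fst)).inv
  simp only [div_eq_mul_inv]
  exact (h1.mul h2.aestronglyMeasurable).integral_prod_right'

lemma opI_eq (U₁ U₂ : ℂ × E3 → ℂ) (z : ℂ) (p : E3) : opI θ ω U₁ U₂ (z, p)
    = -(1 / (Real.pi : ℂ)) * ∫ ζ : ℂ, pair θ ω U₁ U₂ (ζ, p) / (ζ - z) := rfl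

/-- The basic estimate: on almost every slice the defining integral of `I(U₁, U₂)` converges
absolutely for every `λ`, and its value is bounded and continuous in `λ`. -/
lemma exists_opI_bound (μ : ℝ) (hμ : 1 ≤ μ) : ∃ c : ℝ, 0 < c ∧ ∀ (ν : E3) (θ ω : E3 → E3),
    ν ≠ 0 → IsFrame ν θ ω → ∀ U₁ U₂ : ℂ × E3 → ℂ, MemW ν μ U₁ → MemW ν μ U₂ →
      ∀ᵐ p : E3, (∀ z : ℂ, Integrable (fun ζ : ℂ => pair θ ω U₁ U₂ (ζ, p) / (ζ - z)) ∧
        ‖opI θ ω U₁ U₂ (z, p)‖ ≤ c * wNorm ν μ U₁ * wNorm ν μ U₂ * (1 + ‖p‖) ^ (-μ)) ∧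
        Continuous fun z => opI θ ω U₁ U₂ (z, p) := by
  obtain ⟨C, hC, hCauchy⟩ := exists_cauchyTransform_bound
  have hpi := Real.pi_pos
  refine ⟨1 / Real.pi * (C * (Real.pi ^ 2 / 2 * (8 * 2 ^ μ))), by positivity, ?_⟩
  intro ν θ ω hν h U₁ U₂ h₁ h₂
  have hm := aestronglyMeasurable_pair h hν h₁.aestronglyMeasurable h₂.aestronglyMeasurable
  filter_upwards [ae_slices_of_ae (norm_pair_le h hν hμ h₁ h₂),
    ae_slices_aestronglyMeasurable hm, ae_notMem_axis ν] with p hb hmp hp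
  have hP : 0 < ‖p‖ := norm_pos_iff.2 (ne_zero_of_notMem_axis hp)
  set N₁ := wNorm ν μ U₁ with hN₁
  set N₂ := wNorm ν μ U₂ with hN₂
  have hn₁ : 0 ≤ N₁ := wNorm_nonneg _ _ _
  have hn₂ : 0 ≤ N₂ := wNorm_nonneg _ _ _
  have hs : 0 < min ‖p‖ 1 := lt_min hP one_pos
  set K : ℝ := Real.pi ^ 2 / 2 * (N₁ * N₂ * (8 * 2 ^ μ * (1 + ‖p‖) ^ (-μ))) with hK
  have hK0 : 0 ≤ K := by positivity
  have hb' : ∀ᵐ ζ : ℂ, ‖pair θ ω U₁ U₂ (ζ, p)‖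
      ≤ K * (planeWeight (min ‖p‖ 1) ζ + planeWeight (min ‖p‖ 1)⁻¹ ζ) := by
    filter_upwards [hb] with ζ hζ
    refine hζ.trans_eq ?_
    rw [hK, majorant]
    ring
  have hall := hCauchy (fun ζ => pair θ ω U₁ U₂ (ζ, p)) K _ hK0 hs hmp hb'
  refine ⟨fun z => ⟨(hall z).1, ?_⟩, ?_⟩
  · rw [opI_eq, norm_mul, norm_neg, norm_div, norm_one, Complex.norm_real,
      Real.norm_of_nonneg hpi.le]
    calc 1 / Real.pi * ‖∫ ζ : ℂ, pair θ ω U₁ U₂ (ζ, p) / (ζ - z)‖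
        ≤ 1 / Real.pi * (C * K) := mul_le_mul_of_nonneg_left (hall z).2 (by positivity)
      _ = _ := by rw [hK]; ring
  · simp only [opI_eq]
    exact (continuous_cauchyTransform_of_le_planeWeight hK0 hs hb'
      fun z => (hall z).1).const_mul _

lemma opI_slices_congr (h : pair θ ω U₁ U₂ =ᵐ[volume] pair θ ω V₁ V₂) :
    ∀ᵐ p : E3, ∀ z : ℂ, opI θ ω U₁ U₂ (z, p) = opI θ ω V₁ V₂ (z, p) := by
  filter_upwards [ae_slices_of_ae h] with p hp z
  rw [opI_eq, opI_eq]
  congr 1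
  refine integral_congr_ae ?_
  filter_upwards [hp] with ζ hζ
  rw [hζ]

/-- Linear relations between the quadratic expressions carry over to their Cauchy transforms. -/
lemma opI_slices_smul_add {a : ℂ}
    (h : pair θ ω U₁ U₂ =ᵐ[volume] a • pair θ ω V₁ V₂ + pair θ ω W₁ W₂)
    (hV : ∀ᵐ p : E3, ∀ z : ℂ, Integrable (fun ζ : ℂ => pair θ ω V₁ V₂ (ζ, p) / (ζ - z)))
    (hW : ∀ᵐ p : E3, ∀ z : ℂ, Integrable (fun ζ : ℂ => pair θ ω W₁ W₂ (ζ, p) / (ζ - z))) :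
    ∀ᵐ p : E3, ∀ z : ℂ, opI θ ω U₁ U₂ (z, p)
      = a * opI θ ω V₁ V₂ (z, p) + opI θ ω W₁ W₂ (z, p) := by
  filter_upwards [ae_slices_of_ae h, hV, hW] with p hp hVp hWp z
  have e : ∫ ζ : ℂ, pair θ ω U₁ U₂ (ζ, p) / (ζ - z)
      = ∫ ζ : ℂ, (a * (pair θ ω V₁ V₂ (ζ, p) / (ζ - z)) + pair θ ω W₁ W₂ (ζ, p) / (ζ - z)) := by
    refine integral_congr_ae ?_
    filter_upwards [hp] with ζ hζ
    rw [hζ, Pi.add_apply, Pi.smul_apply, smul_eq_mul]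
    ring
  rw [opI_eq, opI_eq, opI_eq, e, integral_add ((hVp z).const_mul a) (hWp z), integral_const_mul]
  ring

lemma opM_slices
    (hU : ∀ᵐ p : E3, ∀ z : ℂ, Integrable (fun ζ : ℂ => pair θ ω U U (ζ, p) / (ζ - z))) :
    ∀ᵐ p : E3, ∀ z : ℂ,
      opM θ ω lam₀ U (z, p) = opN θ ω U (z, p) - opN θ ω U (lam₀ p, p) := by
  filter_upwards [hU] with p hp z
  have e : ∫ ζ : ℂ, pair θ ω U U (ζ, p) * (1 / (ζ - z) - 1 / (ζ - lam₀ p))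
      = ∫ ζ : ℂ, (pair θ ω U U (ζ, p) / (ζ - z) - pair θ ω U U (ζ, p) / (ζ - lam₀ p)) := by
    congr 1
    funext ζ
    ring
  rw [opM, e, integral_sub (hp z) (hp _), opN, opI_eq, opI_eq]
  ring

end operators

/-! ### Successive approximations -/

section fixedPoint

variable {ν : E3} {μ : ℝ} {U V : ℂ × E3 → ℂ}

lemma wNorm_neg (U : ℂ × E3 → ℂ) : wNorm ν μ (-U) = wNorm ν μ U := by
  unfold wNorm eWNorm
  congr 1
  rw [← eLpNorm_neg]
  congr 1
  funext x
  simp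

lemma wNorm_sub_comm (U V : ℂ × E3 → ℂ) : wNorm ν μ (U - V) = wNorm ν μ (V - U) := by
  rw [← wNorm_neg, neg_sub]

lemma ae_eq_of_wNorm_sub_le_zero (hμ : 0 ≤ μ) (hU : MemW ν μ U) (hV : MemW ν μ V)
    (h : wNorm ν μ (U - V) ≤ 0) : U =ᵐ[volume] V :=
  ((hU.sub hμ hV).wBound.mono h).ae_eq

/-- Completeness of the weighted space along sequences with geometrically decreasing
differences. -/
lemma exists_limit_of_geometric (hμ : 0 ≤ μ) {C q : ℝ} (hq0 : 0 ≤ q) (hq1 : q < 1)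
    {u : ℕ → ℂ × E3 → ℂ} (hu : ∀ n, MemW ν μ (u n))
    (hd : ∀ n, wNorm ν μ (u (n + 1) - u n) ≤ C * q ^ n) :
    ∃ U, MemW ν μ U ∧ ∀ n, wNorm ν μ (U - u n) ≤ C * q ^ n / (1 - q) := by
  have hC : 0 ≤ C := by
    have := (wNorm_nonneg ν μ _).trans (hd 0)
    simpa using this
  have h1q : 0 < 1 - q := by linarith
  have hdx : ∀ᵐ x : ℂ × E3, ∀ n, ‖(u (n + 1) - u n) x‖ ≤ C * q ^ n * (1 + ‖x.2‖) ^ (-μ) :=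
    ae_all_iff.2 fun n => ((hu (n + 1)).sub hμ (hu n)).wBound.mono (hd n)
  have hlim : ∀ᵐ x : ℂ × E3, ∃ l : ℂ, Tendsto (fun n => u n x) atTop (𝓝 l) ∧
      ∀ n, ‖u n x - l‖ ≤ C * q ^ n / (1 - q) * (1 + ‖x.2‖) ^ (-μ) := by
    filter_upwards [hdx] with x hx
    have hdist : ∀ n, dist (u n x) (u (n + 1) x) ≤ C * (1 + ‖x.2‖) ^ (-μ) * q ^ n := fun n => by
      rw [dist_comm, dist_eq_norm]
      exact (hx n).trans_eq (by ring)
    obtain ⟨l, hl⟩ := cauchySeq_tendsto_of_complete (cauchySeq_of_le_geometric _ _ hq1 hdist)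
    refine ⟨l, hl, fun n => ?_⟩
    have := dist_le_of_le_geometric_of_tendsto _ _ hq1 hdist hl n
    rw [dist_eq_norm] at this
    exact this.trans_eq (by ring)
  classical
  let U : ℂ × E3 → ℂ := fun x => limUnder atTop fun n => u n x
  have hU : ∀ᵐ x : ℂ × E3, Tendsto (fun n => u n x) atTop (𝓝 (U x)) ∧
      ∀ n, ‖u n x - U x‖ ≤ C * q ^ n / (1 - q) * (1 + ‖x.2‖) ^ (-μ) := by
    filter_upwards [hlim] with x hx
    obtain ⟨l, hl, hb⟩ := hx
    have : U x = l := hl.limUnder_eq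
    rw [this]
    exact ⟨hl, hb⟩
  have hUm : AEStronglyMeasurable U volume :=
    aestronglyMeasurable_of_tendsto_ae atTop (fun n => (hu n).aestronglyMeasurable)
      (hU.mono fun x hx => hx.1)
  have hb : ∀ n, WBound μ (C * q ^ n / (1 - q)) (U - u n) := fun n => by
    filter_upwards [hU] with x hx
    rw [Pi.sub_apply, norm_sub_rev]
    exact hx.2 n
  refine ⟨U, ?_, fun n => wNorm_le_of_wBound (by positivity) (hb n)⟩
  have : U = (U - u 0) + u 0 := by abel
  rw [this]
  exact (memW_of_wBound hμ (hUm.sub (hu 0).aestronglyMeasurable) (hb 0)).add hμ (hu 0)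

end fixedPoint

/-- Contraction argument in the ball of radius `r`, for a quadratic-type map `M` with the
Lipschitz constant `b (|||U||| + |||V|||)`. -/
lemma exists_fixedPoint {ν : E3} {μ : ℝ} (hμ : 0 ≤ μ) {b r : ℝ} (hb : 0 < b) (hr : 0 < r)
    (hbr : r < 1 / (2 * b)) {M : (ℂ × E3 → ℂ) → ℂ × E3 → ℂ}
    (hM : ∀ U, MemW ν μ U → MemW ν μ (M U))
    (hM2 : ∀ U, MemW ν μ U → wNorm ν μ (M U) ≤ b * wNorm ν μ U ^ 2)
    (hL : ∀ U V, MemW ν μ U → MemW ν μ V → wNorm ν μ (M U - M V)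
      ≤ b * (wNorm ν μ U + wNorm ν μ V) * wNorm ν μ (U - V))
    {U₀ : ℂ × E3 → ℂ} (hU₀ : MemW ν μ U₀) (hU₀r : wNorm ν μ U₀ ≤ r / 2) :
    (∀ n : ℕ, MemW ν μ ((fun V => U₀ + M V)^[n] 0) ∧ wNorm ν μ ((fun V => U₀ + M V)^[n] 0) ≤ r) ∧
    ∃ U, MemW ν μ U ∧ wNorm ν μ U ≤ r ∧ U =ᵐ[volume] U₀ + M U := by
  have hq1 : 2 * b * r < 1 := by
    rw [lt_div_iff₀ (by positivity)] at hbr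
    linarith
  have hq0 : 0 ≤ 2 * b * r := by positivity
  have hstep : ∀ V, MemW ν μ V → wNorm ν μ V ≤ r →
      MemW ν μ (U₀ + M V) ∧ wNorm ν μ (U₀ + M V) ≤ r := by
    intro V hV hVr
    refine ⟨hU₀.add hμ (hM V hV), (wNorm_add_le hU₀ (hM V hV)).trans ?_⟩
    have h1 := hM2 V hV
    have h0 := wNorm_nonneg ν μ V
    have h2 : b * wNorm ν μ V ^ 2 ≤ b * r ^ 2 := by gcongr
    nlinarith
  have hlip : ∀ U V, MemW ν μ U → MemW ν μ V → wNorm ν μ U ≤ r → wNorm ν μ V ≤ r →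
      wNorm ν μ (M U - M V) ≤ 2 * b * r * wNorm ν μ (U - V) := by
    intro U V hU hV hUr hVr
    refine (hL U V hU hV).trans (mul_le_mul_of_nonneg_right ?_ (wNorm_nonneg _ _ _))
    nlinarith
  set T : (ℂ × E3 → ℂ) → ℂ × E3 → ℂ := fun V => U₀ + M V with hT
  have hiter : ∀ n : ℕ, MemW ν μ (T^[n] 0) ∧ wNorm ν μ (T^[n] 0) ≤ r := by
    intro n
    induction n with
    | zero =>
      refine ⟨memW_zero hμ, ?_⟩
      rw [Function.iterate_zero, id, wNorm_zero]
      exact hr.le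
    | succ n ih =>
      rw [Function.iterate_succ_apply']
      exact hstep _ ih.1 ih.2
  refine ⟨hiter, ?_⟩
  have hdiff : ∀ n : ℕ, wNorm ν μ (T^[n + 1] 0 - T^[n] 0) ≤ r * (2 * b * r) ^ n := by
    intro n
    induction n with
    | zero =>
      rw [Function.iterate_zero, id, sub_zero, pow_zero, mul_one]
      exact (hiter 1).2
    | succ n ih =>
      have e : T^[n + 1 + 1] 0 - T^[n + 1] 0 = M (T^[n + 1] 0) - M (T^[n] 0) := by
        rw [Function.iterate_succ_apply' T (n + 1), Function.iterate_succ_apply' T n]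
        simp only [hT]
        abel
      rw [e]
      refine (hlip _ _ (hiter _).1 (hiter _).1 (hiter _).2 (hiter _).2).trans ?_
      calc 2 * b * r * wNorm ν μ (T^[n + 1] 0 - T^[n] 0)
          ≤ 2 * b * r * (r * (2 * b * r) ^ n) := mul_le_mul_of_nonneg_left ih hq0
        _ = _ := by ring
  obtain ⟨U, hU, hUn⟩ := exists_limit_of_geometric hμ hq0 hq1 (fun n => (hiter n).1) hdiff
  have hlim : Tendsto (fun n : ℕ => r * (2 * b * r) ^ n / (1 - 2 * b * r)) atTop (𝓝 0) := by
    have h1 := (tendsto_pow_atTop_nhds_zero_of_lt_one hq0 hq1).const_mul r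
    have h2 := h1.div_const (1 - 2 * b * r)
    simpa using h2
  have hUr : wNorm ν μ U ≤ r := by
    have hlim1 : Tendsto (fun n : ℕ => r * (2 * b * r) ^ n / (1 - 2 * b * r) + r) atTop (𝓝 r) := by
      simpa using hlim.add_const r
    refine ge_of_tendsto' hlim1 fun n => ?_
    have e : U = (U - T^[n] 0) + T^[n] 0 := by abel
    calc wNorm ν μ U = wNorm ν μ ((U - T^[n] 0) + T^[n] 0) := by rw [← e]
      _ ≤ _ := wNorm_add_le (hU.sub hμ (hiter n).1) (hiter n).1
      _ ≤ _ := add_le_add (hUn n) (hiter n).2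
  refine ⟨U, hU, hUr, ae_eq_of_wNorm_sub_le_zero hμ hU (hstep U hU hUr).1 ?_⟩
  have hlim2 : Tendsto (fun n : ℕ => r * (2 * b * r) ^ (n + 1) / (1 - 2 * b * r)
      + 2 * b * r * (r * (2 * b * r) ^ n / (1 - 2 * b * r))) atTop (𝓝 0) := by
    have := ((tendsto_add_atTop_iff_nat 1).2 hlim).add (hlim.const_mul (2 * b * r))
    simpa using this
  refine ge_of_tendsto' hlim2 fun n => ?_
  have e : U - (U₀ + M U) = (U - T^[n + 1] 0) + (M (T^[n] 0) - M U) := by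
    rw [Function.iterate_succ_apply']
    simp only [hT]
    abel
  have h1 := hlip _ _ (hiter n).1 hU (hiter n).2 hUr
  rw [wNorm_sub_comm (T^[n] 0) U] at h1
  rw [e]
  refine (wNorm_add_le (hU.sub hμ (hiter _).1) ((hM _ (hiter n).1).sub hμ (hM U hU))).trans ?_
  exact add_le_add (hUn (n + 1)) (h1.trans (mul_le_mul_of_nonneg_left (hUn n) hq0))

/-- Stability of the solutions in the ball; for equal data it gives uniqueness. -/
lemma wNorm_sub_le_of_fixedPoint {ν : E3} {μ : ℝ} (hμ : 0 ≤ μ) {b r : ℝ} (hb : 0 < b)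
    (hbr : r < 1 / (2 * b)) {M : (ℂ × E3 → ℂ) → ℂ × E3 → ℂ}
    (hM : ∀ U, MemW ν μ U → MemW ν μ (M U))
    (hL : ∀ U V, MemW ν μ U → MemW ν μ V → wNorm ν μ (M U - M V)
      ≤ b * (wNorm ν μ U + wNorm ν μ V) * wNorm ν μ (U - V))
    {U₀ W₀ U W : ℂ × E3 → ℂ} (hU₀ : MemW ν μ U₀) (hW₀ : MemW ν μ W₀)
    (hU : MemW ν μ U) (hUr : wNorm ν μ U ≤ r) (hUe : U =ᵐ[volume] U₀ + M U)
    (hW : MemW ν μ W) (hWr : wNorm ν μ W ≤ r) (hWe : W =ᵐ[volume] W₀ + M W) :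
    wNorm ν μ (U - W) ≤ wNorm ν μ (U₀ - W₀) / (1 - 2 * b * r) := by
  have hq1 : 2 * b * r < 1 := by
    rw [lt_div_iff₀ (by positivity)] at hbr
    linarith
  rw [le_div_iff₀ (by linarith)]
  have e : U - W =ᵐ[volume] (U₀ - W₀) + (M U - M W) := by
    filter_upwards [hUe, hWe] with x h1 h2
    rw [Pi.sub_apply, h1, h2]
    simp only [Pi.add_apply, Pi.sub_apply]
    ring
  have h1 := wNorm_add_le (hU₀.sub hμ hW₀) ((hM U hU).sub hμ (hM W hW))
  rw [← wNorm_congr (ν := ν) (μ := μ) e] at h1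
  have h2 := hL U W hU hW
  have h3 : b * (wNorm ν μ U + wNorm ν μ W) * wNorm ν μ (U - W)
      ≤ 2 * b * r * wNorm ν μ (U - W) :=
    mul_le_mul_of_nonneg_right (by nlinarith) (wNorm_nonneg _ _ _)
  linarith

/-- Speed of convergence of the successive approximations. -/
lemma wNorm_sub_iterate_le {ν : E3} {μ : ℝ} (hμ : 0 ≤ μ) {b r : ℝ} (hb : 0 < b) (hr : 0 < r)
    (hbr : r < 1 / (2 * b)) {M : (ℂ × E3 → ℂ) → ℂ × E3 → ℂ}
    (hM : ∀ U, MemW ν μ U → MemW ν μ (M U))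
    (hM2 : ∀ U, MemW ν μ U → wNorm ν μ (M U) ≤ b * wNorm ν μ U ^ 2)
    (hL : ∀ U V, MemW ν μ U → MemW ν μ V → wNorm ν μ (M U - M V)
      ≤ b * (wNorm ν μ U + wNorm ν μ V) * wNorm ν μ (U - V))
    {U₀ U : ℂ × E3 → ℂ} (hU₀ : MemW ν μ U₀) (hU₀r : wNorm ν μ U₀ ≤ r / 2)
    (hU : MemW ν μ U) (hUr : wNorm ν μ U ≤ r) (hUe : U =ᵐ[volume] U₀ + M U) (n : ℕ) :
    wNorm ν μ (U - (fun V => U₀ + M V)^[n] 0) ≤ r * (2 * b * r) ^ n / (2 * (1 - 2 * b * r)) := by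
  have hq1 : 2 * b * r < 1 := by
    rw [lt_div_iff₀ (by positivity)] at hbr
    linarith
  have hq0 : 0 ≤ 2 * b * r := by positivity
  have hiter := (exists_fixedPoint hμ hb hr hbr hM hM2 hL hU₀ hU₀r).1
  induction n with
  | zero =>
    -- the solution is smaller than the radius suggests: `|||U||| ≤ r / 2 + 2br |||U|||`
    rw [Function.iterate_zero, id, sub_zero, pow_zero, mul_one, ← div_div,
      le_div_iff₀ (by linarith)]
    have h1 := wNorm_add_le hU₀ (hM U hU)
    rw [← wNorm_congr (ν := ν) (μ := μ) hUe] at h1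
    have h2 := hM2 U hU
    have h0 := wNorm_nonneg ν μ U
    have h3 : b * wNorm ν μ U ^ 2 ≤ 2 * b * r * wNorm ν μ U := by
      have : b * wNorm ν μ U ≤ 2 * b * r := by nlinarith
      nlinarith
    linarith
  | succ n ih =>
    rw [Function.iterate_succ_apply']
    obtain ⟨hn, hnr⟩ := hiter n
    set V := (fun V => U₀ + M V)^[n] 0
    have e : U - (U₀ + M V) =ᵐ[volume] M U - M V := by
      filter_upwards [hUe] with x h1
      rw [Pi.sub_apply, h1]
      simp only [Pi.add_apply, Pi.sub_apply]
      ring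
    have h2 := hL U V hU hn
    have h3 : b * (wNorm ν μ U + wNorm ν μ V) * wNorm ν μ (U - V)
        ≤ 2 * b * r * wNorm ν μ (U - V) :=
      mul_le_mul_of_nonneg_right (by nlinarith) (wNorm_nonneg _ _ _)
    rw [wNorm_congr e]
    calc wNorm ν μ (M U - M V) ≤ 2 * b * r * wNorm ν μ (U - V) := h2.trans h3
      _ ≤ 2 * b * r * (r * (2 * b * r) ^ n / (2 * (1 - 2 * b * r))) :=
        mul_le_mul_of_nonneg_left ih hq0
      _ = _ := by ring

end FaddeevInverse

theorem lemma6p1 (μ : ℝ) (hμ : 2 ≤ μ) :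
    ∃ c₆ : ℝ, 0 < c₆ ∧
      ∀ (ν : E3) (θ ω : E3 → E3) (lam₀ : E3 → ℂ),
        ‖ν‖ = 1 →
        IsFrame ν θ ω →
        AEMeasurable lam₀ (volume.restrict (axis ν)ᶜ) →
        (∀ p ∈ (axis ν)ᶜ, ‖lam₀ p‖ = 1) →
        -- the integrals that define the operators converge absolutely
        (∀ U₁ U₂ : ℂ × E3 → ℂ, MemW ν μ U₁ → MemW ν μ U₂ →
          (∀ᵐ x ∂(volume.restrict (dom ν)),
            IntervalIntegrable (braceIntegrand θ ω (lift θ ω U₁) (lift θ ω U₂) x)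
              volume (-Real.pi) Real.pi) ∧
          (∀ᵐ p ∂(volume.restrict (axis ν)ᶜ), ∀ z : ℂ, z ≠ 0 →
            Integrable (fun ζ : ℂ => pair θ ω U₁ U₂ (ζ, p) / (ζ - z)))) ∧
        -- `I` depends only on the almost-everywhere classes of its arguments and is bilinear
        (∀ U₁ V₁ U₂ V₂ : ℂ × E3 → ℂ,
          MemW ν μ U₁ → MemW ν μ V₁ → MemW ν μ U₂ → MemW ν μ V₂ →
          (EqDom ν U₁ V₁ → EqDom ν U₂ V₂ →
            EqSlices ν (opI θ ω U₁ U₂) (opI θ ω V₁ V₂)) ∧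
          (∀ a : ℂ, EqSlices ν (opI θ ω (a • U₁ + V₁) U₂)
            (a • opI θ ω U₁ U₂ + opI θ ω V₁ U₂)) ∧
          (∀ a : ℂ, EqSlices ν (opI θ ω U₁ (a • U₂ + V₂))
            (a • opI θ ω U₁ U₂ + opI θ ω U₁ V₂))) ∧
        -- `M(U)(λ, p) = N(U)(λ, p) - N(U)(λ₀(p), p)`
        (∀ U : ℂ × E3 → ℂ, MemW ν μ U →
          EqSlices ν (opM θ ω lam₀ U)
            (fun x => opN θ ω U x - opN θ ω U (lam₀ x.2, x.2))) ∧
        -- mapping properties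
        (∀ U₁ U₂ : ℂ × E3 → ℂ, MemW ν μ U₁ → MemW ν μ U₂ →
          MemW ν μ (opI θ ω U₁ U₂) ∧ SliceContBdd ν (opI θ ω U₁ U₂)) ∧
        (∀ U : ℂ × E3 → ℂ, MemW ν μ U →
          MemW ν μ (opN θ ω U) ∧ SliceContBdd ν (opN θ ω U) ∧
          MemW ν μ (opM θ ω lam₀ U) ∧ SliceContBdd ν (opM θ ω lam₀ U)) ∧
        -- bounds
        (∀ U₁ U₂ : ℂ × E3 → ℂ, MemW ν μ U₁ → MemW ν μ U₂ →
          wNorm ν μ (opI θ ω U₁ U₂) ≤ c₆ * wNorm ν μ U₁ * wNorm ν μ U₂) ∧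
        (∀ U : ℂ × E3 → ℂ, MemW ν μ U →
          wNorm ν μ (opN θ ω U) ≤ c₆ * wNorm ν μ U ^ 2 ∧
          wNorm ν μ (opM θ ω lam₀ U) ≤ 2 * c₆ * wNorm ν μ U ^ 2) ∧
        -- Lipschitz bounds
        (∀ U₁ U₂ : ℂ × E3 → ℂ, MemW ν μ U₁ → MemW ν μ U₂ →
          wNorm ν μ (opN θ ω U₁ - opN θ ω U₂)
              ≤ c₆ * (wNorm ν μ U₁ + wNorm ν μ U₂) * wNorm ν μ (U₁ - U₂) ∧
          wNorm ν μ (opM θ ω lam₀ U₁ - opM θ ω lam₀ U₂)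
              ≤ 2 * c₆ * (wNorm ν μ U₁ + wNorm ν μ U₂) * wNorm ν μ (U₁ - U₂)) ∧
        -- unique solvability of `U = U₀ + M(U)` by successive approximations, and stability,
        -- for small data
        (∀ r : ℝ, 0 < r → r < 1 / (4 * c₆) →
          ∀ U₀ : ℂ × E3 → ℂ, MemW ν μ U₀ → wNorm ν μ U₀ ≤ r / 2 →
            (∃ U, IsBallSolution ν μ θ ω lam₀ r U₀ U) ∧
            (∀ U V, IsBallSolution ν μ θ ω lam₀ r U₀ U →
              IsBallSolution ν μ θ ω lam₀ r U₀ V → EqDom ν U V) ∧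
            (∀ U, IsBallSolution ν μ θ ω lam₀ r U₀ U → ∀ n : ℕ,
              MemW ν μ ((fun V => U₀ + opM θ ω lam₀ V)^[n] 0) ∧
              wNorm ν μ (U - (fun V => U₀ + opM θ ω lam₀ V)^[n] 0)
                ≤ r * (4 * c₆ * r) ^ n / (2 * (1 - 4 * c₆ * r))) ∧
            (∀ W₀ : ℂ × E3 → ℂ, MemW ν μ W₀ → wNorm ν μ W₀ ≤ r / 2 →
              ∀ U W, IsBallSolution ν μ θ ω lam₀ r U₀ U →
                IsBallSolution ν μ θ ω lam₀ r W₀ W →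
                wNorm ν μ (U - W) ≤ wNorm ν μ (U₀ - W₀) / (1 - 4 * c₆ * r))) := by
  have hμ0 : 0 ≤ μ := by linarith
  obtain ⟨c, hc, hmain⟩ := exists_opI_bound μ (by linarith)
  refine ⟨c, hc, ?_⟩
  intro ν θ ω lam₀ hν1 hF hlam _
  have hν : ν ≠ 0 := by
    rintro rfl
    simp at hν1
  have hlam' : AEMeasurable lam₀ volume := by rwa [restrict_axis_compl] at hlam
  have hμ1 : 1 ≤ μ := by linarith
  -- absolute convergence on almost every slice
  have hint : ∀ U₁ U₂, MemW ν μ U₁ → MemW ν μ U₂ → ∀ᵐ p : E3, ∀ z : ℂ,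
      Integrable (fun ζ : ℂ => pair θ ω U₁ U₂ (ζ, p) / (ζ - z)) := fun U₁ U₂ h₁ h₂ =>
    (hmain ν θ ω hν hF U₁ U₂ h₁ h₂).mono fun p hp z => (hp.1 z).1
  have hbd : ∀ U₁ U₂, MemW ν μ U₁ → MemW ν μ U₂ → ∀ᵐ p : E3, ∀ z : ℂ,
      ‖opI θ ω U₁ U₂ (z, p)‖ ≤ c * wNorm ν μ U₁ * wNorm ν μ U₂ * (1 + ‖p‖) ^ (-μ) :=
    fun U₁ U₂ h₁ h₂ => (hmain ν θ ω hν hF U₁ U₂ h₁ h₂).mono fun p hp z => (hp.1 z).2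
  have hcont : ∀ U₁ U₂, MemW ν μ U₁ → MemW ν μ U₂ → ∀ᵐ p : E3,
      Continuous fun z => opI θ ω U₁ U₂ (z, p) :=
    fun U₁ U₂ h₁ h₂ => (hmain ν θ ω hν hF U₁ U₂ h₁ h₂).mono fun p hp => hp.2
  have hMs : ∀ U, MemW ν μ U → ∀ᵐ p : E3, ∀ z : ℂ,
      opM θ ω lam₀ U (z, p) = opN θ ω U (z, p) - opN θ ω U (lam₀ p, p) :=
    fun U hU => opM_slices (hint U U hU hU)
  -- bilinearity on slices
  have hlinL : ∀ (a : ℂ) U₁ V₁ U₂, MemW ν μ U₁ → MemW ν μ V₁ → MemW ν μ U₂ → ∀ᵐ p : E3, ∀ z : ℂ,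
      opI θ ω (a • U₁ + V₁) U₂ (z, p) = a * opI θ ω U₁ U₂ (z, p) + opI θ ω V₁ U₂ (z, p) :=
    fun a U₁ V₁ U₂ h₁ hV h₂ => opI_slices_smul_add
      (pair_smul_add_left hF hν hμ1 a h₁ h₂ hV) (hint _ _ h₁ h₂) (hint _ _ hV h₂)
  have hlinR : ∀ (a : ℂ) U₁ U₂ V₂, MemW ν μ U₁ → MemW ν μ U₂ → MemW ν μ V₂ → ∀ᵐ p : E3, ∀ z : ℂ,
      opI θ ω U₁ (a • U₂ + V₂) (z, p) = a * opI θ ω U₁ U₂ (z, p) + opI θ ω U₁ V₂ (z, p) :=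
    fun a U₁ U₂ V₂ h₁ h₂ hV => opI_slices_smul_add
      (pair_smul_add_right hF hν hμ1 a h₁ h₂ hV) (hint _ _ h₁ h₂) (hint _ _ h₁ hV)
  -- `N(U₁) - N(U₂) = I(U₁ - U₂, U₁) + I(U₂, U₁ - U₂)`
  have hNdiff : ∀ U₁ U₂, MemW ν μ U₁ → MemW ν μ U₂ → ∀ᵐ p : E3, ∀ z : ℂ,
      ‖opN θ ω U₁ (z, p) - opN θ ω U₂ (z, p)‖
        ≤ c * (wNorm ν μ U₁ + wNorm ν μ U₂) * wNorm ν μ (U₁ - U₂) * (1 + ‖p‖) ^ (-μ) := by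
    intro U₁ U₂ h₁ h₂
    have hd := h₁.sub hμ0 h₂
    have e : (1 : ℂ) • (U₁ - U₂) + U₂ = U₁ := by rw [one_smul, sub_add_cancel]
    have hA := hlinL 1 (U₁ - U₂) U₂ U₁ hd h₂ h₁
    have hB := hlinR 1 U₂ (U₁ - U₂) U₂ h₂ hd h₂
    rw [e] at hA hB
    filter_upwards [hA, hB, hbd _ _ hd h₁, hbd _ _ h₂ hd] with p h3 h4 h5 h6 z
    have e2 : opN θ ω U₁ (z, p) - opN θ ω U₂ (z, p)
        = opI θ ω (U₁ - U₂) U₁ (z, p) + opI θ ω U₂ (U₁ - U₂) (z, p) := by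
      rw [opN, opN, h3 z, h4 z]
      ring
    rw [e2]
    refine (norm_add_le _ _).trans ((add_le_add (h5 z) (h6 z)).trans_eq ?_)
    ring
  have hIm : ∀ U₁ U₂, MemW ν μ U₁ → MemW ν μ U₂ →
      AEStronglyMeasurable (opI θ ω U₁ U₂) volume := fun U₁ U₂ h₁ h₂ =>
    (aestronglyMeasurable_cauchyTransform (aestronglyMeasurable_pair hF hν
      h₁.aestronglyMeasurable h₂.aestronglyMeasurable) measurable_fst.aemeasurable).const_mul _
  have hNm : ∀ U, MemW ν μ U →
      AEStronglyMeasurable (fun x : ℂ × E3 => opN θ ω U (lam₀ x.2, x.2)) volume := fun U hU =>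
    (aestronglyMeasurable_cauchyTransform (aestronglyMeasurable_pair hF hν
      hU.aestronglyMeasurable hU.aestronglyMeasurable)
      (hlam'.comp_quasiMeasurePreserving Measure.quasiMeasurePreserving_snd)).const_mul _
  have hIb : ∀ U₁ U₂, MemW ν μ U₁ → MemW ν μ U₂ →
      WBound μ (c * wNorm ν μ U₁ * wNorm ν μ U₂) (opI θ ω U₁ U₂) := fun U₁ U₂ h₁ h₂ =>
    ae_of_ae_slices ((hbd U₁ U₂ h₁ h₂).mono fun p hp z _ => hp z)
  have hMae : ∀ U, MemW ν μ U → ∀ᵐ x : ℂ × E3,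
      opM θ ω lam₀ U x = opN θ ω U x - opN θ ω U (lam₀ x.2, x.2) := fun U hU =>
    ae_of_ae_slices ((hMs U hU).mono fun p hp z _ => hp z)
  have hMm : ∀ U, MemW ν μ U → AEStronglyMeasurable (opM θ ω lam₀ U) volume := fun U hU =>
    ((hIm U U hU hU).sub (hNm U hU)).congr ((hMae U hU).mono fun x hx => hx.symm)
  have hMb : ∀ U, MemW ν μ U → WBound μ (2 * c * wNorm ν μ U ^ 2) (opM θ ω lam₀ U) := by
    intro U hU
    refine ae_of_ae_slices ?_
    filter_upwards [hMs U hU, hbd U U hU hU] with p h1 h2 z _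
    rw [h1 z]
    refine (norm_sub_le _ _).trans ((add_le_add (h2 z) (h2 (lam₀ p))).trans_eq ?_)
    ring
  have hMdb : ∀ U₁ U₂, MemW ν μ U₁ → MemW ν μ U₂ →
      WBound μ (2 * c * (wNorm ν μ U₁ + wNorm ν μ U₂) * wNorm ν μ (U₁ - U₂))
        (opM θ ω lam₀ U₁ - opM θ ω lam₀ U₂) := by
    intro U₁ U₂ h₁ h₂
    refine ae_of_ae_slices ?_
    filter_upwards [hMs U₁ h₁, hMs U₂ h₂, hNdiff U₁ U₂ h₁ h₂] with p h3 h4 h5 z _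
    have e : (opM θ ω lam₀ U₁ - opM θ ω lam₀ U₂) (z, p)
        = (opN θ ω U₁ (z, p) - opN θ ω U₂ (z, p))
          - (opN θ ω U₁ (lam₀ p, p) - opN θ ω U₂ (lam₀ p, p)) := by
      rw [Pi.sub_apply, h3 z, h4 z]
      ring
    rw [e]
    refine (norm_sub_le _ _).trans ((add_le_add (h5 z) (h5 (lam₀ p))).trans_eq ?_)
    ring
  have hIW : ∀ U₁ U₂, MemW ν μ U₁ → MemW ν μ U₂ → MemW ν μ (opI θ ω U₁ U₂) :=
    fun U₁ U₂ h₁ h₂ => memW_of_wBound hμ0 (hIm U₁ U₂ h₁ h₂) (hIb U₁ U₂ h₁ h₂)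
  have hMW : ∀ U, MemW ν μ U → MemW ν μ (opM θ ω lam₀ U) :=
    fun U hU => memW_of_wBound hμ0 (hMm U hU) (hMb U hU)
  have hIS : ∀ U₁ U₂, MemW ν μ U₁ → MemW ν μ U₂ → SliceContBdd ν (opI θ ω U₁ U₂) := by
    intro U₁ U₂ h₁ h₂
    rw [SliceContBdd, restrict_axis_compl]
    filter_upwards [hcont U₁ U₂ h₁ h₂, hbd U₁ U₂ h₁ h₂] with p h3 h4
    exact ⟨h3.continuousOn, memLp_top_of_bound h3.aestronglyMeasurable _ (ae_of_all _ h4)⟩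
  have hMS : ∀ U, MemW ν μ U → SliceContBdd ν (opM θ ω lam₀ U) := by
    intro U hU
    rw [SliceContBdd, restrict_axis_compl]
    filter_upwards [hMs U hU, hcont U U hU hU, hbd U U hU hU] with p h1 h3 h4
    have e : (fun z => opM θ ω lam₀ U (z, p))
        = fun z => opI θ ω U U (z, p) - opI θ ω U U (lam₀ p, p) := funext h1
    have h5 : Continuous fun z => opI θ ω U U (z, p) - opI θ ω U U (lam₀ p, p) :=
      h3.sub continuous_const
    rw [e]
    exact ⟨h5.continuousOn, memLp_top_of_bound h5.aestronglyMeasurable _ (ae_of_all _ fun z =>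
      (norm_sub_le _ _).trans (add_le_add (h4 z) (h4 (lam₀ p))))⟩
  have hIN : ∀ U₁ U₂, MemW ν μ U₁ → MemW ν μ U₂ →
      wNorm ν μ (opI θ ω U₁ U₂) ≤ c * wNorm ν μ U₁ * wNorm ν μ U₂ := fun U₁ U₂ h₁ h₂ =>
    wNorm_le_of_wBound (mul_nonneg (mul_nonneg hc.le (wNorm_nonneg _ _ _)) (wNorm_nonneg _ _ _))
      (hIb U₁ U₂ h₁ h₂)
  have hMN : ∀ U, MemW ν μ U → wNorm ν μ (opM θ ω lam₀ U) ≤ 2 * c * wNorm ν μ U ^ 2 :=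
    fun U hU => wNorm_le_of_wBound (by positivity) (hMb U hU)
  have hfac : ∀ U₁ U₂, 0 ≤ c * (wNorm ν μ U₁ + wNorm ν μ U₂) * wNorm ν μ (U₁ - U₂) :=
    fun U₁ U₂ => mul_nonneg (mul_nonneg hc.le
      (add_nonneg (wNorm_nonneg _ _ _) (wNorm_nonneg _ _ _))) (wNorm_nonneg _ _ _)
  have hML : ∀ U₁ U₂, MemW ν μ U₁ → MemW ν μ U₂ →
      wNorm ν μ (opM θ ω lam₀ U₁ - opM θ ω lam₀ U₂)
        ≤ 2 * c * (wNorm ν μ U₁ + wNorm ν μ U₂) * wNorm ν μ (U₁ - U₂) := fun U₁ U₂ h₁ h₂ =>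
    wNorm_le_of_wBound (by linarith [hfac U₁ U₂]) (hMdb U₁ U₂ h₁ h₂)
  refine ⟨fun U₁ U₂ h₁ h₂ => ⟨?_, ?_⟩, fun U₁ V₁ U₂ V₂ h₁ hV₁ h₂ hV₂ => ⟨fun he₁ he₂ => ?_,
    fun a => ?_, fun a => ?_⟩, fun U hU => ?_, fun U₁ U₂ h₁ h₂ => ⟨hIW U₁ U₂ h₁ h₂, hIS U₁ U₂ h₁ h₂⟩,
    fun U hU => ⟨hIW U U hU hU, hIS U U hU hU, hMW U hU, hMS U hU⟩, hIN,
    fun U hU => ⟨(hIN U U hU hU).trans_eq (by ring), hMN U hU⟩,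
    fun U₁ U₂ h₁ h₂ => ⟨?_, hML U₁ U₂ h₁ h₂⟩, fun r hr hrc U₀ hU₀ hU₀r => ?_⟩
  · rw [restrict_dom]
    exact ae_intervalIntegrable_braceIntegrand hF hν hμ1 h₁ h₂
  · rw [restrict_axis_compl]
    exact (hint U₁ U₂ h₁ h₂).mono fun p hp z _ => hp z
  · rw [EqSlices, restrict_axis_compl]
    exact (opI_slices_congr (pair_congr hF hν (eqDom_iff.1 he₁) (eqDom_iff.1 he₂))).mono
      fun p hp z _ => hp z
  · rw [EqSlices, restrict_axis_compl]
    exact (hlinL a U₁ V₁ U₂ h₁ hV₁ h₂).mono fun p hp z _ => hp z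
  · rw [EqSlices, restrict_axis_compl]
    exact (hlinR a U₁ U₂ V₂ h₁ h₂ hV₂).mono fun p hp z _ => hp z
  · rw [EqSlices, restrict_axis_compl]
    exact (hMs U hU).mono fun p hp z _ => hp z
  · exact wNorm_le_of_wBound (hfac U₁ U₂)
      (ae_of_ae_slices ((hNdiff U₁ U₂ h₁ h₂).mono fun p hp z _ => hp z))
  · have hb : 0 < 2 * c := by positivity
    have h4 : 2 * (2 * c) = 4 * c := by ring
    have hrc' : r < 1 / (2 * (2 * c)) := by rwa [h4]
    refine ⟨?_, fun U V hU hV => ?_, fun U hU n => ⟨?_, ?_⟩, fun W₀ hW₀ _ U W hU hW => ?_⟩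
    · obtain ⟨U, hU, hUr, hUe⟩ := (exists_fixedPoint hμ0 hb hr hrc' hMW hMN hML hU₀ hU₀r).2
      exact ⟨U, hU, hUr, eqDom_iff.2 hUe⟩
    · have h5 := wNorm_sub_le_of_fixedPoint hμ0 hb hrc' hMW hML hU₀ hU₀ hU.1 hU.2.1
        (eqDom_iff.1 hU.2.2) hV.1 hV.2.1 (eqDom_iff.1 hV.2.2)
      rw [sub_self, wNorm_zero, zero_div] at h5
      exact eqDom_iff.2 (ae_eq_of_wNorm_sub_le_zero hμ0 hU.1 hV.1 h5)
    · exact ((exists_fixedPoint hμ0 hb hr hrc' hMW hMN hML hU₀ hU₀r).1 n).1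
    · have h5 := wNorm_sub_iterate_le hμ0 hb hr hrc' hMW hMN hML hU₀ hU₀r hU.1 hU.2.1
        (eqDom_iff.1 hU.2.2) n
      rwa [h4] at h5
    · have h5 := wNorm_sub_le_of_fixedPoint hμ0 hb hrc' hMW hML hU₀ hW₀ hU.1 hU.2.1
        (eqDom_iff.1 hU.2.2) hW.1 hW.2.1 (eqDom_iff.1 hW.2.2)
      rwa [h4] at h5
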